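/- Let $d\ge 1$. For $n\in\mathbb N_0$ let $\mathcal H_n^d$ be the space of real harmonic homogeneous polynomials of degree $n$ in $d$ variables, let $a_n^d=\dim\mathcal H_n^d$, and let $\{Y_\ell^n:1\le \ell\le a_n^d\}\subset\mathcal H_n^d$ be any basis that is orthonormal in $L^2(\mathbb S^{d-1},d\sigma)$, where $\sigma$ is the surface measure (for $d=1$, the counting measure on $\{-1,1\}$). For $\mu>-\tfrac12$, $k\in\mathbb N_0$, $n\in\mathbb N_0$ and $1\le\ell\le a_n^d$, let $L_k^{(\alpha)}$ denote the generalised Laguerre polynomial and define the generalised Hermite functions (GHFs) $$\widehat H_{k,\ell}^{\mu,n}(x)=\frac{1}{\sqrt{\gamma_{k,n}^{\mu,d}}}\,e^{-|x|^2/2}\,L_k^{(n+\frac{d-2}{2}+\mu)}(|x|^2)\,Y_\ell^n(x),\qquad \gamma_{k,n}^{\mu,d}=\frac{\Gamma(k+n+\frac d2+\mu)}{2\,k!},$$ and the adjoint generalised Hermite functions (A-GHFs) $$\check H_{k,\ell}^{\mu,n}(x)=\sum_{j=0}^k(-1)^{k-j}\,C_{k,j}^{\mu}\,\widehat H_{j,\ell}^{0,n}(x),\qquad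 C_{k,j}^{\mu}=\frac{(\mu)_{k-j}}{(k-j)!}\sqrt{\frac{k!\,\Gamma(j+n+\frac d2)}{j!\,\Gamma(k+n+\frac d2+\mu)}},$$ where $(\mu)_m=\mu(\mu+1)\cdots(\mu+m-1)$, $(\mu)_0=1$ (that is, $(\mu)_m=\Gamma(\mu+m)/\Gamma(\mu)$ for $\mu\ne0$, and $C_{k,j}^{0}=\delta_{kj}$). Let $$\mathscr F[u](\xi)=\frac1{(2\pi)^{d/2}}\int_{\mathbb R^d}u(x)e^{-\mathrm i\langle\xi,x\rangle}\,dx,\qquad \mathscr F^{-1}[v](x)=\frac1{(2\pi)^{d/2}}\int_{\mathbb R^d}v(\xi)e^{\mathrm i\langle\xi,x\rangle}\,d\xi,$$ and $(-\Delta)^su=\mathscr F^{-1}\big[|\xi|^{2s}\mathscr F[u](\xi)\big]$ for $s>0$, and $(u,v)_{\mathbb R^d}=\int_{\mathbb R^d}u\,\bar v\,dx$. Then, for all $\mu>-\tfrac12$, $n,k\in\mathbb N_0$ and $1\le \ell\le a_n^d$, the functions $\check H_{k,\ell}^{\mu,n}$ and $\widehat H_{k,\ell}^{\mu,n}$ are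 integrable and, for all $\xi,x\in\mathbb R^d$, $$\mathscr F[\check H_{k,\ell}^{\mu,n}](\xi)=(-\mathrm i)^{n+2k}\,\widehat H_{k,\ell}^{\mu,n}(\xi),\qquad \mathscr F^{-1}[\widehat H_{k,\ell}^{\mu,n}](x)=\mathrm i^{\,n+2k}\,\check H_{k,\ell}^{\mu,n}(x);$$ moreover, for every $s>0$, the functions $|\xi|^{2s}\mathscr F[\check H_{k,\ell}^{\mu,n}](\xi)$ and $(-\Delta)^s\check H_{k,\ell}^{\mu,n}$ are integrable and, for all $\xi\in\mathbb R^d$, $$\mathscr F[(-\Delta)^s\check H_{k,\ell}^{\mu,n}](\xi)=(-\mathrm i)^{n+2k}\,|\xi|^{2s}\,\widehat H_{k,\ell}^{\mu,n}(\xi).$$ Finally, for every $s>0$, all $n,m,k,j\in\mathbb N_0$, $1\le\ell\le a_n^d$ and $1\le\iota\le a_m^d$, the functions $(-\Delta)^{s/2}\check H_{k,\ell}^{s,n}$ are in $L^2(\mathbb R^d)$ and $$\big((-\Delta)^{s/2}\check H_{k,\ell}^{s,n},\,(-\Delta)^{s/2}\check H_{j,\iota}^{s,m}\big)_{\mathbb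 R^d}=\delta_{jk}\,\delta_{mn}\,\delta_{\ell\iota}.$$ -/

import Mathlib

open MeasureTheory

noncomputable section

/-- The Euclidean space `ℝ^d`. -/
abbrev Rd (d : ℕ) : Type := EuclideanSpace ℝ (Fin d)

/-- The value at `x ∈ ℝ^d` of a real polynomial in `d` variables. -/
def polyVal {d : ℕ} (P : MvPolynomial (Fin d) ℝ) (x : Rd d) : ℝ :=
  MvPolynomial.eval (fun i => x i) P

/-- The Laplacian `Δ = ∑ ∂²/∂x_i²` on real polynomials in `d` variables. -/
def polyLaplacian (d : ℕ) : MvPolynomial (Fin d) ℝ →ₗ[ℝ] MvPolynomial (Fin d) ℝ :=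
  ∑ i : Fin d, (MvPolynomial.pderiv i).toLinearMap ∘ₗ (MvPolynomial.pderiv i).toLinearMap

/-- The space `𝓗_n^d` of real harmonic homogeneous polynomials of degree `n` in `d` variables. -/
def harmonicPoly (d n : ℕ) : Submodule ℝ (MvPolynomial (Fin d) ℝ) :=
  MvPolynomial.homogeneousSubmodule (Fin d) ℝ n ⊓ LinearMap.ker (polyLaplacian d)

/-- The dimension `a_n^d = dim 𝓗_n^d`. -/
def harmonicDim (d n : ℕ) : ℕ := Module.finrank ℝ (harmonicPoly d n)

/-- The inner product `∫ P Q dσ` over the unit sphere `𝕊^{d-1}`, where `σ` is the (unnormalised)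
surface measure; for `d = 1` it is the counting measure on `{-1, 1}`. -/
def sphereInner {d : ℕ} (P Q : MvPolynomial (Fin d) ℝ) : ℝ :=
  ∫ x : Metric.sphere (0 : Rd d) 1, polyVal P x * polyVal Q x
    ∂(volume : Measure (Rd d)).toSphere

/-- `Y n ℓ`, with `ℓ` running through `a_n^d` indices, are real orthonormal spherical harmonic
bases: for every `n`, the family `Y n` consists of `a_n^d = dim 𝓗_n^d` elements of `𝓗_n^d` that
are orthonormal on the unit sphere (hence form a basis of `𝓗_n^d`). Orthogonality of different
degrees is not part of the hypothesis. -/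
structure IsSphericalHarmonicBasis (d : ℕ)
    (Y : (n : ℕ) → Fin (harmonicDim d n) → MvPolynomial (Fin d) ℝ) : Prop where
  mem : ∀ n ℓ, Y n ℓ ∈ harmonicPoly d n
  orthonormal : ∀ n ℓ ι, sphereInner (Y n ℓ) (Y n ι) = if ℓ = ι then 1 else 0

/-- The rising factorial `(a)_m = a (a + 1) ⋯ (a + m - 1)`, `(a)_0 = 1`; it equals
`Γ(a + m) / Γ(a)` whenever `a` is not a pole of `Γ`. -/
def risingFactorial (a : ℝ) (m : ℕ) : ℝ := (ascPochhammer ℝ m).eval a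

/-- The rising factorial is the quotient `Γ(a + m) / Γ(a)` off the poles of `Γ`. -/
theorem risingFactorial_eq_Gamma_div (a : ℝ) (m : ℕ) (h : ∀ k : ℕ, a ≠ -k) :
    risingFactorial a m = Real.Gamma (a + m) / Real.Gamma a := by
  induction m with
  | zero => simp [risingFactorial, Real.Gamma_ne_zero h]
  | succ m ih =>
    have hm : a + m ≠ 0 := fun h0 => h m (by linarith)
    have e : a + (m + 1 : ℕ) = (a + m) + 1 := by push_cast; ring
    rw [e, Real.Gamma_add_one hm]
    simp only [risingFactorial] at *
    rw [ascPochhammer_succ_eval, ih]; ring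

/-- The generalised Laguerre polynomial
`L_k^{(α)}(z) = ∑_{j ≤ k} (-1)^j binom(k + α, k - j) z^j / j!`, where
`binom(k + α, k - j) = (α + j + 1)_{k - j} / (k - j)!`. -/
def genLaguerre (k : ℕ) (α z : ℝ) : ℝ :=
  ∑ j ∈ Finset.range (k + 1),
    (-1) ^ j * (risingFactorial (α + j + 1) (k - j) / (k - j).factorial) * (z ^ j / j.factorial)

/-- The generalised Hermite polynomial
`H_{k,ℓ}^{μ,n}(x) = L_k^{(n + (d-2)/2 + μ)}(|x|²) Y_ℓ^n(x)`, with `P = Y_ℓ^n`. -/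
def genHermitePoly {d : ℕ} (μ : ℝ) (n k : ℕ) (P : MvPolynomial (Fin d) ℝ) (x : Rd d) : ℝ :=
  genLaguerre k (n + ((d : ℝ) - 2) / 2 + μ) (‖x‖ ^ 2) * polyVal P x

/-- The normalisation constant `γ_{k,n}^{μ,d} = Γ(k + n + d/2 + μ) / (2 k!)`. -/
def hermiteGamma (d : ℕ) (μ : ℝ) (n k : ℕ) : ℝ :=
  Real.Gamma (k + n + (d : ℝ) / 2 + μ) / (2 * k.factorial)

/-- The generalised Hermite function (GHF) `Ĥ_{k,ℓ}^{μ,n}`, with `P = Y_ℓ^n`. -/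
def genHermiteFun {d : ℕ} (μ : ℝ) (n k : ℕ) (P : MvPolynomial (Fin d) ℝ) (x : Rd d) : ℝ :=
  √(1 / hermiteGamma d μ n k) * Real.exp (-‖x‖ ^ 2 / 2) * genHermitePoly μ n k P x

/-- The connection coefficient from parameter `ν` to parameter `μ`,
`Γ(k - j + μ - ν) / (Γ(μ - ν) (k - j)!) * √(k! Γ(j + n + d/2 + ν) / (j! Γ(k + n + d/2 + μ)))`
for `j ≤ k`. The quotient `Γ(k - j + μ - ν) / Γ(μ - ν)` is written as the rising factorial
`(μ - ν)_{k - j}`, which is also its limit at the poles of `Γ`; so for `μ = ν` the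
coefficient is `δ_{kj}`. -/
def connectionCoeff (d n : ℕ) (μ ν : ℝ) (k j : ℕ) : ℝ :=
  risingFactorial (μ - ν) (k - j) / (k - j).factorial *
    √((k.factorial * Real.Gamma (j + n + (d : ℝ) / 2 + ν)) /
      (j.factorial * Real.Gamma (k + n + (d : ℝ) / 2 + μ)))

/-- The adjoint generalised Hermite function (A-GHF) `Ȟ_{k,ℓ}^{μ,n}`, with `P = Y_ℓ^n`. -/
def adjHermiteFun {d : ℕ} (μ : ℝ) (n k : ℕ) (P : MvPolynomial (Fin d) ℝ) (x : Rd d) : ℝ :=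
  ∑ j ∈ Finset.range (k + 1),
    (-1) ^ (k - j) * connectionCoeff d n μ 0 k j * genHermiteFun 0 n j P x

/-- The Fourier transform `(2π)^{-d/2} ∫ u(x) e^{-i⟨ξ,x⟩} dx`. -/
def fourierT {d : ℕ} (u : Rd d → ℂ) (ξ : Rd d) : ℂ :=
  ((1 / (2 * Real.pi) ^ ((d : ℝ) / 2) : ℝ) : ℂ) *
    ∫ x : Rd d, u x * Complex.exp (-(Complex.I * ((inner ℝ ξ x : ℝ) : ℂ)))

/-- The inverse Fourier transform `(2π)^{-d/2} ∫ v(ξ) e^{i⟨ξ,x⟩} dξ`. -/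
def fourierTInv {d : ℕ} (v : Rd d → ℂ) (x : Rd d) : ℂ :=
  ((1 / (2 * Real.pi) ^ ((d : ℝ) / 2) : ℝ) : ℂ) *
    ∫ ξ : Rd d, v ξ * Complex.exp (Complex.I * ((inner ℝ ξ x : ℝ) : ℂ))

/-- The fractional Laplacian `(-Δ)^s u = 𝓕⁻¹[|ξ|^{2s} 𝓕[u](ξ)]`. -/
def fracLaplacian {d : ℕ} (s : ℝ) (u : Rd d → ℂ) : Rd d → ℂ :=
  fourierTInv fun ξ => ((‖ξ‖ ^ (2 * s) : ℝ) : ℂ) * fourierT u ξ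

/-- The `L²(ℝ^d)` inner product `(u, v) = ∫ u v̄ dx`. -/
def innerRd {d : ℕ} (u v : Rd d → ℂ) : ℂ :=
  ∫ x : Rd d, u x * (starRingEnd ℂ) (v x)

/-- A real-valued function on `ℝ^d` regarded as complex-valued. -/
def toComplexFun {d : ℕ} (u : Rd d → ℝ) : Rd d → ℂ := fun x => (u x : ℂ)

end

/-!
Write `g(x) = e^{-|x|²/2}`, `α = n + (d - 2)/2`, and let `P` be a harmonic homogeneous polynomial of
degree `n`.

Transform pairs. Integration by parts gives `𝓕[x_i Q g] = 𝓕[(∂_i Q) g] - i ξ_i 𝓕[Q g]` for every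
polynomial `Q` (`gaussFT_X_mul`). Summed with Euler's identity this makes `P g` an eigenfunction,
`𝓕[P g] = (-i)^n P g` (`gaussFT_harmonic`), and turns the transforms of `|x|^{2j} P g` into the
three-term recurrence solved by `2^j j! L_j^{(α)}(|ξ|²/2)` (`gaussFT_normSqPoly_pow_mul`). Summing
against the coefficients of `L_k^{(α)}` shows that the GHFs with `μ = 0` are eigenfunctions with
eigenvalue `(-i)^{n+2k}`. By the connection formula for Laguerre polynomials (`genLaguerre_add`,
Chu–Vandermonde), the GHF of parameter `μ` is `∑_j C_{k,j}^μ Ĥ_j^0`; the signs `(-1)^{k-j}` of the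
A-GHF are exactly what makes all the eigenvalues `(-i)^{n+2j}` into `(-i)^{n+2k}`.

Integrability of the fractional Laplacian. It has to be shown that the inverse transform of
`|ξ|^{2s} |ξ|^{2j} P g` is integrable, although this function is not smooth at the origin. For an
integer `m > s`, `|ξ|^{2s}` is `|ξ|^{2m}` times a superposition of `e^{-r|ξ|²}` with weight
`r^{m-s-1} dr / Γ(m-s)`, and on a homogeneous polynomial times `g` a factor `e^{-r|ξ|²}` acts as the
dilation by `(1 + 2r)^{1/2}`, up to a power of `1 + 2r`. So the transform is a superposition of
dilates of one integrable function, with integrable weight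
(`integrable_fourierT_rpow_mul_polyGauss`). Fourier inversion and Parseval's identity are then
available.

Orthonormality. Parseval reduces it to `∫ |ξ|^{2s} Ĥ_k^{s,n} Ĥ_j^{s,m} dξ`, which polar coordinates
split into an integral over the sphere and a radial integral. Harmonics of different degrees are
orthogonal by Green's formula for the Gaussian weight (`sphereInner_eq_zero`). In equal degrees the
radial integral is the orthogonality relation of the Laguerre polynomials of parameter `α + s`
(`integral_genLaguerre_mul_genLaguerre`).
-/

noncomputable section

/-! ### Polynomials and their Laplacian -/

section Polynomials

variable {d : ℕ}

open MvPolynomial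

/-- The polynomial `|x|² = ∑ x_i²`. -/
def normSqPoly (d : ℕ) : MvPolynomial (Fin d) ℝ := ∑ i : Fin d, X i * X i

lemma polyVal_add (P Q : MvPolynomial (Fin d) ℝ) (x : Rd d) :
    polyVal (P + Q) x = polyVal P x + polyVal Q x := by simp [polyVal]

lemma polyVal_mul (P Q : MvPolynomial (Fin d) ℝ) (x : Rd d) :
    polyVal (P * Q) x = polyVal P x * polyVal Q x := by simp [polyVal]

lemma polyVal_smul (c : ℝ) (P : MvPolynomial (Fin d) ℝ) (x : Rd d) :
    polyVal (c • P) x = c * polyVal P x := by simp [polyVal]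

lemma polyVal_pow (P : MvPolynomial (Fin d) ℝ) (j : ℕ) (x : Rd d) :
    polyVal (P ^ j) x = polyVal P x ^ j := by simp [polyVal]

lemma polyVal_X (i : Fin d) (x : Rd d) : polyVal (X i) x = x i := by simp [polyVal]

lemma polyVal_normSqPoly (x : Rd d) : polyVal (normSqPoly d) x = ‖x‖ ^ 2 := by
  rw [EuclideanSpace.norm_sq_eq]
  simp [polyVal, normSqPoly, pow_two]

lemma continuous_polyVal (P : MvPolynomial (Fin d) ℝ) : Continuous (polyVal P) :=
  (MvPolynomial.continuous_eval P).comp (by fun_prop)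

lemma polyVal_const_smul {n : ℕ} {P : MvPolynomial (Fin d) ℝ} (hP : P.IsHomogeneous n) (c : ℝ)
    (x : Rd d) : polyVal P (c • x) = c ^ n * polyVal P x := by
  simp only [polyVal, eval_eq, Finset.mul_sum]
  refine Finset.sum_congr rfl fun m hm => ?_
  have hd : ∑ i ∈ m.support, m i = n := by
    simpa [Finsupp.weight_apply, Finsupp.sum] using hP (mem_support_iff.mp hm)
  simp only [PiLp.smul_apply, smul_eq_mul, mul_pow, Finset.prod_mul_distrib,
    Finset.prod_pow_eq_pow_sum, hd]
  ring

lemma polyLaplacian_apply (P : MvPolynomial (Fin d) ℝ) :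
    polyLaplacian d P = ∑ i, pderiv i (pderiv i P) := by
  simp [polyLaplacian, LinearMap.sum_apply]

lemma mem_harmonicPoly {n : ℕ} {P : MvPolynomial (Fin d) ℝ} :
    P ∈ harmonicPoly d n ↔ P.IsHomogeneous n ∧ polyLaplacian d P = 0 := by
  simp [harmonicPoly, mem_homogeneousSubmodule]

lemma pderiv_comm (i j : Fin d) (P : MvPolynomial (Fin d) ℝ) :
    pderiv i (pderiv j P) = pderiv j (pderiv i P) := by
  induction P using MvPolynomial.induction_on with
  | C a => simp
  | add p q hp hq => simp [hp, hq]
  | mul_X p k hp =>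
    simp only [Derivation.leibniz, map_add, hp, pderiv_X, smul_eq_mul]
    have hz : ∀ (a b : Fin d), pderiv a ((Pi.single b 1 : Fin d → MvPolynomial (Fin d) ℝ) k) = 0 :=
      fun a b => by by_cases h : k = b <;> simp [h]
    rw [hz, hz]
    ring

/-- For `n = 0` the derivative vanishes, so the truncated degree `n - 1` does no harm. -/
lemma pderiv_mem_harmonicPoly {n : ℕ} {P : MvPolynomial (Fin d) ℝ} (hP : P ∈ harmonicPoly d n)
    (i : Fin d) : pderiv i P ∈ harmonicPoly d (n - 1) := by
  rw [mem_harmonicPoly] at hP ⊢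
  refine ⟨hP.1.pderiv, ?_⟩
  have : polyLaplacian d (pderiv i P) = pderiv i (polyLaplacian d P) := by
    simp only [polyLaplacian_apply, map_sum]
    exact Finset.sum_congr rfl fun j _ => by rw [pderiv_comm j i, pderiv_comm j i]
  rw [this, hP.2, map_zero]

lemma isHomogeneous_normSqPoly : (normSqPoly d).IsHomogeneous 2 :=
  IsHomogeneous.sum _ _ _ fun i _ => (isHomogeneous_X ℝ i).mul (isHomogeneous_X ℝ i)

lemma isHomogeneous_normSqPoly_pow_mul {n : ℕ} {P : MvPolynomial (Fin d) ℝ}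
    (hP : P.IsHomogeneous n) (j : ℕ) : (normSqPoly d ^ j * P).IsHomogeneous (2 * j + n) :=
  (isHomogeneous_normSqPoly.pow j).mul hP

lemma pderiv_normSqPoly (i : Fin d) : pderiv i (normSqPoly d) = 2 * X i := by
  simp only [normSqPoly, map_sum, Derivation.leibniz, pderiv_X, smul_eq_mul]
  rw [Finset.sum_eq_single i]
  · simp; ring
  · intro j _ hj; simp [hj]
  · simp

/-- The Laplacian of `|x|² P`, where Euler's identity evaluates the cross term. -/
lemma polyLaplacian_normSqPoly_mul {m : ℕ} {P : MvPolynomial (Fin d) ℝ}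
    (hP : P.IsHomogeneous m) :
    polyLaplacian d (normSqPoly d * P) =
      (2 * d + 4 * m : ℝ) • P + normSqPoly d * polyLaplacian d P := by
  have e : ∀ i, pderiv i (pderiv i (normSqPoly d * P)) =
      2 * P + 4 * (X i * pderiv i P) + normSqPoly d * pderiv i (pderiv i P) := by
    intro i
    have h2 : pderiv i (2 : MvPolynomial (Fin d) ℝ) = 0 := by
      simpa using (pderiv i).map_natCast 2
    simp only [Derivation.leibniz, map_add, pderiv_normSqPoly, smul_eq_mul, h2, pderiv_X_self]
    ring
  simp only [polyLaplacian_apply, e, Finset.sum_add_distrib, ← Finset.mul_sum,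
    hP.sum_X_mul_pderiv]
  simp only [Finset.sum_const, Finset.card_univ, Fintype.card_fin, nsmul_eq_mul, smul_eq_C_mul,
    map_add, map_mul, map_natCast, map_ofNat]
  ring

/-- The Laplacian of `|x|^{2j} P` for harmonic `P`. At `j = 0` the factor `4 j` makes the truncated
exponent `j - 1` immaterial. -/
lemma polyLaplacian_normSqPoly_pow_mul {n : ℕ} {P : MvPolynomial (Fin d) ℝ}
    (hP : P ∈ harmonicPoly d n) (j : ℕ) :
    polyLaplacian d (normSqPoly d ^ j * P) =
      (4 * j * (j + (n + ((d : ℝ) - 2) / 2))) • (normSqPoly d ^ (j - 1) * P) := by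
  rw [mem_harmonicPoly] at hP
  induction j with
  | zero => simp [hP.2]
  | succ j ih =>
    rw [pow_succ', mul_assoc,
      polyLaplacian_normSqPoly_mul (isHomogeneous_normSqPoly_pow_mul hP.1 j), ih]
    have h1 : normSqPoly d *
        ((4 * j * (j + (n + ((d : ℝ) - 2) / 2))) • (normSqPoly d ^ (j - 1) * P)) =
        (4 * j * (j + (n + ((d : ℝ) - 2) / 2))) • (normSqPoly d ^ j * P) := by
      rcases j with _ | j
      · simp
      · rw [mul_smul_comm, Nat.add_sub_cancel, pow_succ']
        ring_nf
    rw [h1, ← add_smul, Nat.add_sub_cancel]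
    congr 1
    push_cast
    ring

end Polynomials

/-! ### Polynomials times a Gaussian -/

section Gaussian

variable {d : ℕ}

open MvPolynomial

/-- A polynomial times a Gaussian of any positive width is integrable. -/
lemma integrable_polyVal_mul_exp (P : MvPolynomial (Fin d) ℝ) {a : ℝ} (ha : 0 < a) :
    Integrable fun x : Rd d => polyVal P x * Real.exp (-a * ‖x‖ ^ 2) := by
  induction P using MvPolynomial.induction_on generalizing a with
  | C c =>
    have h := (GaussianFourier.integrable_cexp_neg_mul_sq_norm_add (V := Rd d) (b := (a : ℂ))
      (by simpa using ha) 0 0).re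
    have := h.const_mul c
    refine this.congr (.of_forall fun x => ?_)
    simp [polyVal, ← Complex.ofReal_pow, ← Complex.ofReal_mul, ← Complex.ofReal_neg, Complex.exp_ofReal_re]
  | add p q hp hq =>
    simpa [polyVal_add, add_mul] using! (hp ha).add (hq ha)
  | mul_X p i hp =>
    have h := hp (half_pos ha)
    -- Half of the Gaussian bounds the extra coordinate, the other half is left for `p`.
    have hb : ∀ x : Rd d, ‖x i * Real.exp (-(a / 2) * ‖x‖ ^ 2)‖ ≤ 1 / (a / 2) + 1 := by
      intro x
      have hx : |x i| ≤ ‖x‖ := by simpa using PiLp.norm_apply_le x i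
      have h1 : ‖x‖ ≤ ‖x‖ ^ 2 + 1 := by nlinarith [sq_nonneg (‖x‖ - 1), norm_nonneg x]
      have h2 : (a / 2) * ‖x‖ ^ 2 + 1 ≤ Real.exp ((a / 2) * ‖x‖ ^ 2) := Real.add_one_le_exp _
      have h3 : 0 < a / 2 := half_pos ha
      have hE : 0 < Real.exp ((a / 2) * ‖x‖ ^ 2) := Real.exp_pos _
      rw [norm_mul, neg_mul, Real.exp_neg, Real.norm_eq_abs, Real.norm_eq_abs, abs_inv,
        abs_of_pos hE, ← div_eq_mul_inv, div_le_iff₀ hE]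
      have h4 : (1 / (a / 2) + 1) * ((a / 2) * ‖x‖ ^ 2 + 1) =
        ‖x‖ ^ 2 + 1 + (1 / (a / 2) + (a / 2) * ‖x‖ ^ 2) := by field_simp; ring
      have h5 : 0 ≤ 1 / (a / 2) + (a / 2) * ‖x‖ ^ 2 := by positivity
      have h6 : 0 < 1 / (a / 2) + 1 := by positivity
      nlinarith [mul_le_mul_of_nonneg_left h2 h6.le]
    have := h.bdd_mul (c := 1 / (a / 2) + 1) (f := fun x : Rd d => x i * Real.exp (-(a / 2) * ‖x‖ ^ 2))
      (by fun_prop) (.of_forall hb)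
    refine this.congr (.of_forall fun x => ?_)
    simp only [polyVal_mul, polyVal_X]
    rw [show -a * ‖x‖ ^ 2 = -(a / 2) * ‖x‖ ^ 2 + -(a / 2) * ‖x‖ ^ 2 by ring, Real.exp_add]
    ring

/-- The function `x ↦ P(x) e^{-|x|²/2}`. -/
def polyGauss (P : MvPolynomial (Fin d) ℝ) (x : Rd d) : ℝ :=
  polyVal P x * Real.exp (-‖x‖ ^ 2 / 2)

lemma continuous_polyGauss (P : MvPolynomial (Fin d) ℝ) : Continuous (polyGauss P) := by
  have := continuous_polyVal P
  unfold polyGauss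
  fun_prop

lemma integrable_polyGauss (P : MvPolynomial (Fin d) ℝ) : Integrable (polyGauss P) := by
  refine (integrable_polyVal_mul_exp P (a := 1 / 2) (by norm_num)).congr (.of_forall fun x => ?_)
  simp only [polyGauss]
  ring_nf

lemma hasLineDerivAt_polyVal (P : MvPolynomial (Fin d) ℝ) (i : Fin d) (x : Rd d) :
    HasLineDerivAt ℝ (polyVal P) (polyVal (pderiv i P) x) x (EuclideanSpace.single i 1) := by
  unfold HasLineDerivAt
  induction P using MvPolynomial.induction_on with
  | C a => simpa [polyVal] using! hasDerivAt_const (0 : ℝ) a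
  | add p q hp hq => simpa [polyVal] using! hp.add hq
  | mul_X p k hp =>
    have h1 : HasDerivAt (fun t : ℝ => (x + t • EuclideanSpace.single i (1 : ℝ)) k)
        ((Pi.single i 1 : Fin d → ℝ) k) 0 := by
      have := ((hasDerivAt_id (0 : ℝ)).mul_const ((Pi.single i 1 : Fin d → ℝ) k)).const_add (x k)
      rw [one_mul] at this
      exact this
    have := hp.mul h1
    convert! this using 1
    · ext t; simp [polyVal]
    · by_cases h : k = i
      · subst h; simp [polyVal]; ring
      · simp [polyVal, h]; ring

lemma hasLineDerivAt_polyGauss (P : MvPolynomial (Fin d) ℝ) (i : Fin d) (x : Rd d) :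
    HasLineDerivAt ℝ (polyGauss P) (polyGauss (pderiv i P - X i * P) x) x
      (EuclideanSpace.single i 1) := by
  have h1 : HasLineDerivAt ℝ (fun x : Rd d => Real.exp (-‖x‖ ^ 2 / 2))
      (Real.exp (-‖x‖ ^ 2 / 2) * -x i) x (EuclideanSpace.single i 1) := by
    have h2 := ((hasLineDerivAt_polyVal (normSqPoly d) i x).neg.div_const 2).exp
    simp only [polyVal_normSqPoly, pderiv_normSqPoly] at h2
    unfold HasLineDerivAt
    convert! h2 using 1
    simp [polyVal]
    ring
  have := (hasLineDerivAt_polyVal P i x).mul h1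
  unfold HasLineDerivAt
  convert! this using 1
  simp [polyGauss, polyVal]
  ring

end Gaussian

/-! ### Rising factorials and Laguerre polynomials -/

section Laguerre

open Finset

lemma risingFactorial_zero (a : ℝ) : risingFactorial a 0 = 1 := by simp [risingFactorial]

lemma risingFactorial_succ (a : ℝ) (m : ℕ) :
    risingFactorial a (m + 1) = risingFactorial a m * (a + m) := by
  simp [risingFactorial, ascPochhammer_succ_eval]

lemma risingFactorial_add (a : ℝ) (m n : ℕ) :
    risingFactorial a (m + n) = risingFactorial a m * risingFactorial (a + m) n := by
  simp [risingFactorial, ← ascPochhammer_mul]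

lemma risingFactorial_succ_left (a : ℝ) (m : ℕ) :
    risingFactorial a (m + 1) = a * risingFactorial (a + 1) m := by
  rw [add_comm m 1, risingFactorial_add, risingFactorial_succ, risingFactorial_zero]
  simp

/-- The Chu–Vandermonde identity for rising factorials. -/
lemma risingFactorial_add_div_factorial (a b : ℝ) (n : ℕ) :
    risingFactorial (a + b) n / n.factorial =
      ∑ p ∈ antidiagonal n, risingFactorial a p.1 / p.1.factorial *
        (risingFactorial b p.2 / p.2.factorial) := by
  have hr : ∀ (c : ℝ) (m : ℕ), (m + 1 : ℝ) * (risingFactorial c (m + 1) / (m + 1).factorial) =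
      (c + m) * (risingFactorial c m / m.factorial) := by
    intro c m
    rw [risingFactorial_succ, Nat.factorial_succ]
    push_cast
    field_simp
  induction n with
  | zero => simp [risingFactorial_zero]
  | succ n ih =>
    have hn : (n + 1 : ℝ) ≠ 0 := by positivity
    refine mul_left_cancel₀ hn ?_
    rw [hr, ih, mul_sum, mul_sum]
    -- Weight each term of the right side by `n + 1 = p.1 + p.2` and lower one index at a time.
    have h1 : ∑ p ∈ antidiagonal (n + 1), (n + 1 : ℝ) * (risingFactorial a p.1 / p.1.factorial *
        (risingFactorial b p.2 / p.2.factorial)) =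
        ∑ p ∈ antidiagonal (n + 1), (p.1 : ℝ) * (risingFactorial a p.1 / p.1.factorial) *
          (risingFactorial b p.2 / p.2.factorial) +
        ∑ p ∈ antidiagonal (n + 1), (risingFactorial a p.1 / p.1.factorial) *
          ((p.2 : ℝ) * (risingFactorial b p.2 / p.2.factorial)) := by
      rw [← sum_add_distrib]
      refine sum_congr rfl fun p hp => ?_
      have : (n + 1 : ℝ) = p.1 + p.2 := by exact_mod_cast (mem_antidiagonal.mp hp).symm
      rw [this]; ring
    rw [h1, Nat.sum_antidiagonal_succ, Nat.sum_antidiagonal_succ']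
    push_cast
    simp only [hr, zero_mul, mul_zero, zero_add]
    rw [← sum_add_distrib]
    refine sum_congr rfl fun p hp => ?_
    have : (n : ℝ) = p.1 + p.2 := by exact_mod_cast (mem_antidiagonal.mp hp).symm
    rw [this]; ring

/-- The coefficient of `z ^ i` in `L_k^{(α)}(z)`, for `i ≤ k`. -/
def laguerreCoeff (k : ℕ) (α : ℝ) (i : ℕ) : ℝ :=
  (-1) ^ i * (risingFactorial (α + i + 1) (k - i) / (k - i).factorial) / i.factorial

lemma genLaguerre_eq_sum (k : ℕ) (α z : ℝ) :
    genLaguerre k α z = ∑ i ∈ range (k + 1), laguerreCoeff k α i * z ^ i :=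
  sum_congr rfl fun i _ => by rw [laguerreCoeff]; ring

/-- Interchange of summations over the triangle `i ≤ j ≤ k`. -/
lemma sum_range_triangle (f : ℕ → ℕ → ℝ) (k : ℕ) :
    ∑ j ∈ range (k + 1), ∑ i ∈ range (j + 1), f j i =
      ∑ i ∈ range (k + 1), ∑ m ∈ range (k - i + 1), f (i + m) i := by
  have h := sum_range_diag_flip (k + 1) fun i m => f (i + m) i
  rw [sum_congr rfl fun i hi => ?_] at h
  · rw [h]
    refine sum_congr rfl fun i hi => ?_
    rw [Nat.sub_add_comm (by simpa [Nat.lt_succ_iff] using hi)]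
  · refine sum_congr rfl fun m hm => ?_
    rw [Nat.add_sub_cancel' (by simpa [Nat.lt_succ_iff] using hm)]

/-- The connection formula between Laguerre polynomials of parameters `α + μ` and `α`. -/
lemma genLaguerre_add (k : ℕ) (α μ z : ℝ) :
    genLaguerre k (α + μ) z = ∑ j ∈ range (k + 1),
      risingFactorial μ (k - j) / (k - j).factorial * genLaguerre j α z := by
  simp only [genLaguerre_eq_sum, mul_sum]
  rw [sum_range_triangle]
  refine sum_congr rfl fun i hi => ?_
  have hik : i ≤ k := by simpa [Nat.lt_succ_iff] using hi
  have e : α + μ + i + 1 = (α + i + 1) + μ := by ring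
  rw [laguerreCoeff, e, risingFactorial_add_div_factorial, Nat.sum_antidiagonal_eq_sum_range_succ_mk,
    mul_sum, sum_div, sum_mul]
  refine sum_congr rfl fun m _ => ?_
  rw [laguerreCoeff, Nat.add_sub_cancel_left, Nat.sub_add_eq]
  ring

/-- The Laguerre polynomial `L_k^{(α)}` expanded in the polynomials `L_j^{(α)}(z / 2)`, as needed
for the Fourier transform of its monomials. -/
lemma sum_laguerreCoeff_mul_genLaguerre_half (k : ℕ) (α z : ℝ) :
    ∑ j ∈ range (k + 1), laguerreCoeff k α j * (2 ^ j * j.factorial * genLaguerre j α (z / 2)) =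
      (-1) ^ k * genLaguerre k α z := by
  simp only [genLaguerre_eq_sum, mul_sum]
  rw [sum_range_triangle]
  refine sum_congr rfl fun i hi => ?_
  have hik : i ≤ k := by simpa [Nat.lt_succ_iff] using hi
  obtain ⟨M, rfl⟩ := Nat.exists_eq_add_of_le hik
  have hb : ((-1 : ℝ)) ^ M = ∑ m ∈ range (M + 1), (-2) ^ m * (M.choose m : ℝ) := by
    have := add_pow (-2 : ℝ) 1 M
    norm_num at this
    exact this
  have hs : ((-1 : ℝ)) ^ (i + M) = (-1) ^ i * (-1) ^ M := pow_add _ _ _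
  rw [hs, hb, Nat.add_sub_cancel_left, mul_sum, sum_mul]
  refine sum_congr rfl fun m hm => ?_
  obtain ⟨p, rfl⟩ := Nat.exists_eq_add_of_le (Nat.lt_succ_iff.mp (mem_range.mp hm))
  have e1 : i + (m + p) - (i + m) = p := by omega
  have e2 : α + ((i + m : ℕ) : ℝ) + 1 = α + i + 1 + m := by push_cast; ring
  have e3 : ((m + p).choose m : ℝ) = (m + p).factorial / (m.factorial * p.factorial) := by
    rw [Nat.cast_choose ℝ (Nat.le_add_right m p), Nat.add_sub_cancel_left]
  have h2 : ((-2 : ℝ)) ^ m = (-1) ^ m * 2 ^ m := by rw [← mul_pow]; norm_num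
  have hz : (z / 2) ^ i * 2 ^ (i + m) = z ^ i * 2 ^ m := by
    rw [div_pow, pow_add]; field_simp
  simp only [laguerreCoeff, e1, e2, e3, h2, Nat.add_sub_cancel_left]
  rw [risingFactorial_add]
  have f1 : ((i + m).factorial : ℝ) ≠ 0 := by positivity
  have f2 : ((m + p).factorial : ℝ) ≠ 0 := by positivity
  calc _ = (-1) ^ (i + m) * (-1) ^ i * risingFactorial (α + i + 1 + m) p *
        risingFactorial (α + i + 1) m / (p.factorial * m.factorial * i.factorial) *
        ((z / 2) ^ i * 2 ^ (i + m)) := by field_simp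
    _ = _ := by rw [hz]; field_simp; ring

/-- The three-term recurrence of the Laguerre polynomials. -/
lemma genLaguerre_succ_succ (k : ℕ) (α z : ℝ) :
    (k + 2) * genLaguerre (k + 2) α z =
      (2 * k + 3 + α - z) * genLaguerre (k + 1) α z - (k + 1 + α) * genLaguerre k α z := by
  have fs : ∀ n : ℕ, ((n + 1).factorial : ℝ) = (n + 1) * n.factorial := fun n => by
    rw [Nat.factorial_succ]; push_cast; ring
  -- the recurrence for the coefficients away from the ends
  have key : ∀ i m : ℕ, (i + m + 3 : ℝ) * laguerreCoeff (i + m + 3) α (i + 1) =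
      (2 * (i + m + 1) + 3 + α) * laguerreCoeff (i + m + 2) α (i + 1)
        - laguerreCoeff (i + m + 2) α i - (i + m + 2 + α) * laguerreCoeff (i + m + 1) α (i + 1) := by
    intro i m
    have e1 : i + m + 3 - (i + 1) = m + 2 := by omega
    have e2 : i + m + 2 - (i + 1) = m + 1 := by omega
    have e3 : i + m + 2 - i = m + 2 := by omega
    have e4 : i + m + 1 - (i + 1) = m := by omega
    have e5 : α + ((i + 1 : ℕ) : ℝ) + 1 = α + i + 1 + 1 := by push_cast; ring
    simp only [laguerreCoeff, e1, e2, e3, e4, e5]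
    rw [risingFactorial_succ_left (α + i + 1) (m + 1)]
    simp only [risingFactorial_succ, fs, pow_succ]
    push_cast
    field_simp
    ring
  have key0 : (k + 2 : ℝ) * laguerreCoeff (k + 2) α 0 =
      (2 * k + 3 + α) * laguerreCoeff (k + 1) α 0 - (k + 1 + α) * laguerreCoeff k α 0 := by
    simp only [laguerreCoeff, Nat.sub_zero, risingFactorial_succ, fs]
    push_cast
    field_simp
    ring
  have key1 : (k + 2 : ℝ) * laguerreCoeff (k + 2) α (k + 1) =
      (2 * k + 3 + α) * laguerreCoeff (k + 1) α (k + 1) - laguerreCoeff (k + 1) α k := by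
    have e1 : k + 2 - (k + 1) = 1 := by omega
    have e2 : k + 1 - (k + 1) = 0 := by omega
    have e3 : k + 1 - k = 1 := by omega
    simp only [laguerreCoeff, e1, e2, e3, risingFactorial_succ, risingFactorial_zero, pow_succ,
      Nat.factorial]
    push_cast
    field_simp
    ring
  have key2 : (k + 2 : ℝ) * laguerreCoeff (k + 2) α (k + 2) = - laguerreCoeff (k + 1) α (k + 1) := by
    simp only [laguerreCoeff, Nat.sub_self, risingFactorial_zero, fs, pow_succ]
    push_cast
    field_simp
    ring
  have keyk : ∀ i ∈ range k, (k + 2 : ℝ) * laguerreCoeff (k + 2) α (i + 1) =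
      (2 * k + 3 + α) * laguerreCoeff (k + 1) α (i + 1)
        - laguerreCoeff (k + 1) α i - (k + 1 + α) * laguerreCoeff k α (i + 1) := by
    intro i hi
    obtain ⟨m, rfl⟩ := Nat.exists_eq_add_of_lt (mem_range.mp hi)
    have := key i m
    push_cast at this ⊢
    convert this using 2 <;> ring
  have S2 : genLaguerre (k + 2) α z = laguerreCoeff (k + 2) α 0 +
      ∑ i ∈ range k, laguerreCoeff (k + 2) α (i + 1) * z ^ (i + 1) +
      laguerreCoeff (k + 2) α (k + 1) * z ^ (k + 1) +
      laguerreCoeff (k + 2) α (k + 2) * z ^ (k + 2) := by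
    rw [genLaguerre_eq_sum, sum_range_succ, sum_range_succ, sum_range_succ']
    ring
  have S1 : genLaguerre (k + 1) α z = laguerreCoeff (k + 1) α 0 +
      ∑ i ∈ range k, laguerreCoeff (k + 1) α (i + 1) * z ^ (i + 1) +
      laguerreCoeff (k + 1) α (k + 1) * z ^ (k + 1) := by
    rw [genLaguerre_eq_sum, sum_range_succ, sum_range_succ']
    ring
  have S1' : z * genLaguerre (k + 1) α z =
      ∑ i ∈ range k, laguerreCoeff (k + 1) α i * z ^ (i + 1) +
      laguerreCoeff (k + 1) α k * z ^ (k + 1) +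
      laguerreCoeff (k + 1) α (k + 1) * z ^ (k + 2) := by
    rw [genLaguerre_eq_sum, mul_sum]
    rw [sum_range_succ, sum_range_succ]
    simp only [pow_succ]
    congr 1
    · congr 1
      · exact sum_congr rfl fun i _ => by ring
      · ring
    · ring
  have S0 : genLaguerre k α z = laguerreCoeff k α 0 +
      ∑ i ∈ range k, laguerreCoeff k α (i + 1) * z ^ (i + 1) := by
    rw [genLaguerre_eq_sum, sum_range_succ']
    ring
  have hsum : (k + 2 : ℝ) * ∑ i ∈ range k, laguerreCoeff (k + 2) α (i + 1) * z ^ (i + 1) =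
      (2 * k + 3 + α) * ∑ i ∈ range k, laguerreCoeff (k + 1) α (i + 1) * z ^ (i + 1) -
      ∑ i ∈ range k, laguerreCoeff (k + 1) α i * z ^ (i + 1) -
      (k + 1 + α) * ∑ i ∈ range k, laguerreCoeff k α (i + 1) * z ^ (i + 1) := by
    simp only [mul_sum]
    rw [← sum_sub_distrib, ← sum_sub_distrib]
    refine sum_congr rfl fun i hi => ?_
    rw [← mul_assoc, keyk i hi]
    ring
  rw [sub_mul, S1', S2, S1, S0]
  linear_combination key0 + hsum + z ^ (k + 1) * key1 + z ^ (k + 2) * key2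

/-- The `j`-th finite difference of the rising factorial `β ↦ (β)_i`. -/
lemma sum_neg_one_pow_mul_choose_mul_risingFactorial (β : ℝ) (i j : ℕ) :
    ∑ l ∈ range (j + 1), (-1) ^ l * (j.choose l : ℝ) * risingFactorial (β + l) i =
      (-1) ^ j * (i.descFactorial j : ℝ) * risingFactorial (β + j) (i - j) := by
  induction j generalizing i β with
  | zero => simp
  | succ j ih =>
    have hd : ∀ l : ℕ, risingFactorial (β + l) i - risingFactorial (β + (l + 1 : ℕ)) i =
        -(i * risingFactorial (β + 1 + l) (i - 1)) := by
      intro l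
      rcases i with _ | i
      · simp [risingFactorial_zero]
      · rw [risingFactorial_succ_left, risingFactorial_succ]
        push_cast
        rw [show β + (l + 1 : ℝ) = β + l + 1 by ring,
          show β + 1 + (l : ℝ) = β + l + 1 by ring]
        ring
    have hp : ∑ l ∈ range (j + 1 + 1), (-1) ^ l * ((j + 1).choose l : ℝ) *
        risingFactorial (β + l) i = ∑ l ∈ range (j + 1), (-1) ^ l * (j.choose l : ℝ) *
          (risingFactorial (β + l) i - risingFactorial (β + (l + 1 : ℕ)) i) := by
      rw [sum_range_succ']
      simp only [Nat.choose_succ_succ', Nat.cast_add, mul_add, add_mul, mul_sub, sum_add_distrib,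
        sum_sub_distrib]
      have h1 := sum_range_succ' (fun l => (-1) ^ l * (j.choose l : ℝ) *
        risingFactorial (β + l) i) (j + 1)
      rw [sum_range_succ] at h1
      simp at h1 ⊢
      rw [h1]
      simp only [pow_succ, mul_neg, mul_one, neg_mul, sum_neg_distrib]
      ring
    rw [hp]
    simp only [hd]
    have := ih (β + 1) (i - 1)
    calc _ = -(i : ℝ) * ∑ l ∈ range (j + 1), (-1) ^ l * (j.choose l : ℝ) *
          risingFactorial (β + 1 + l) (i - 1) := by
          rw [mul_sum]; exact sum_congr rfl fun l _ => by ring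
      _ = _ := by
        rw [this]
        rcases i with _ | i
        · simp
        · rw [Nat.succ_descFactorial_succ]
          have e : i + 1 - 1 - j = i + 1 - (j + 1) := by omega
          rw [e]
          push_cast
          rw [show β + 1 + (j : ℝ) = β + (j + 1) by ring]
          simp
          ring

lemma Gamma_add_natCast_eq_risingFactorial_mul {a : ℝ} (ha : 0 < a) (m : ℕ) :
    Real.Gamma (a + m) = risingFactorial a m * Real.Gamma a := by
  have h : ∀ k : ℕ, a ≠ -k := fun k h => by
    have : (0 : ℝ) ≤ k := k.cast_nonneg
    linarith
  rw [risingFactorial_eq_Gamma_div a m h, div_mul_cancel₀ _ (Real.Gamma_pos_of_pos ha).ne']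

/-- The moments of a Laguerre polynomial against its own weight. -/
lemma sum_laguerreCoeff_mul_Gamma {α : ℝ} (hα : -1 < α) (i j : ℕ) :
    ∑ l ∈ range (j + 1), laguerreCoeff j α l * Real.Gamma (α + 1 + i + l) =
      Real.Gamma (α + 1 + j) / j.factorial * ((-1) ^ j * (i.descFactorial j : ℝ) *
        risingFactorial (α + 1 + j) (i - j)) := by
  rw [← sum_neg_one_pow_mul_choose_mul_risingFactorial, mul_sum]
  refine sum_congr rfl fun l hl => ?_
  obtain ⟨p, rfl⟩ := Nat.exists_eq_add_of_le (Nat.lt_succ_iff.mp (mem_range.mp hl))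
  have hp : 0 < α + 1 + (l : ℝ) := by
    have : (0 : ℝ) ≤ l := l.cast_nonneg
    linarith
  have h1 := Gamma_add_natCast_eq_risingFactorial_mul hp i
  have h2 := Gamma_add_natCast_eq_risingFactorial_mul hp p
  rw [Nat.cast_add, ← add_assoc, h2, show α + 1 + (i : ℝ) + l = α + 1 + l + i by ring, h1,
    laguerreCoeff, Nat.add_sub_cancel_left, Nat.cast_choose ℝ (Nat.le_add_right l p),
    Nat.add_sub_cancel_left, show α + (l : ℝ) + 1 = α + 1 + l by ring]
  have f2 : ((l + p).factorial : ℝ) ≠ 0 := by positivity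
  field_simp

/-- Orthogonality of the Laguerre polynomials, with the integrals `∫ z^{α+i+l} e^{-z} dz` written
as values of `Γ`. -/
lemma sum_laguerreCoeff_mul_laguerreCoeff_mul_Gamma {α : ℝ} (hα : -1 < α) (k j : ℕ) :
    ∑ i ∈ range (k + 1), ∑ l ∈ range (j + 1),
      laguerreCoeff k α i * laguerreCoeff j α l * Real.Gamma (α + 1 + i + l) =
      if j = k then Real.Gamma (α + 1 + k) / k.factorial else 0 := by
  wlog hkj : k ≤ j generalizing k j with H
  · have h := H j k (le_of_not_ge hkj)
    rw [sum_comm]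
    have hne : j ≠ k := by omega
    rw [if_neg hne.symm] at h
    rw [if_neg hne, ← h]
    refine sum_congr rfl fun i _ => sum_congr rfl fun l _ => ?_
    rw [show α + 1 + (l : ℝ) + i = α + 1 + i + l by ring]
    ring
  have h1 : ∀ i ∈ range (k + 1), ∑ l ∈ range (j + 1),
      laguerreCoeff k α i * laguerreCoeff j α l * Real.Gamma (α + 1 + i + l) =
      laguerreCoeff k α i * (Real.Gamma (α + 1 + j) / j.factorial *
        ((-1) ^ j * (i.descFactorial j : ℝ) * risingFactorial (α + 1 + j) (i - j))) := by
    intro i _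
    rw [← sum_laguerreCoeff_mul_Gamma hα, mul_sum]
    exact sum_congr rfl fun l _ => by ring
  rw [sum_congr rfl h1, sum_range_succ, sum_eq_zero, zero_add]
  · split_ifs with h
    · subst h
      have hs : ((-1 : ℝ)) ^ j * (-1) ^ j = 1 := by rw [← mul_pow]; norm_num
      simp only [laguerreCoeff, Nat.sub_self, risingFactorial_zero, Nat.descFactorial_self,
        Nat.factorial_zero, Nat.cast_one]
      field_simp
      linear_combination Real.Gamma (α + 1 + j) * hs
    · rw [Nat.descFactorial_of_lt (by omega)]
      simp
  · intro i hi
    rw [Nat.descFactorial_of_lt (by have := mem_range.mp hi; omega)]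
    simp

end Laguerre

/-! ### Fourier transforms of polynomials times a Gaussian -/

section GaussianFourier

variable {d : ℕ}

open MvPolynomial Finset

lemma norm_fourierKernel (x ξ : Rd d) :
    ‖Complex.exp (-(Complex.I * ((inner ℝ ξ x : ℝ) : ℂ)))‖ = 1 := by
  rw [← mul_neg, mul_comm, ← Complex.ofReal_neg, Complex.norm_exp_ofReal_mul_I]

lemma integrable_mul_fourierKernel {u : Rd d → ℂ} (hu : Integrable u) (ξ : Rd d) :
    Integrable fun x : Rd d => u x * Complex.exp (-(Complex.I * ((inner ℝ ξ x : ℝ) : ℂ))) :=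
  hu.mul_bdd (c := 1) (by fun_prop) (.of_forall fun x => (norm_fourierKernel x ξ).le)

lemma fourierT_add {u v : Rd d → ℂ} (hu : Integrable u) (hv : Integrable v) (ξ : Rd d) :
    fourierT (fun x => u x + v x) ξ = fourierT u ξ + fourierT v ξ := by
  simp only [fourierT]
  rw [← mul_add, ← integral_add (integrable_mul_fourierKernel hu ξ)
    (integrable_mul_fourierKernel hv ξ)]
  simp only [add_mul]

lemma fourierT_const_mul (c : ℂ) (u : Rd d → ℂ) (ξ : Rd d) :
    fourierT (fun x => c * u x) ξ = c * fourierT u ξ := by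
  simp only [fourierT, mul_assoc]
  rw [integral_const_mul]
  ring

lemma integrable_toComplexFun {u : Rd d → ℝ} (hu : Integrable u) :
    Integrable (toComplexFun u) := hu.ofReal

/-- The value at `ξ` of the Fourier transform of `P(x) e^{-|x|²/2}`, as a linear functional
of the polynomial `P`. -/
def gaussFT (ξ : Rd d) : MvPolynomial (Fin d) ℝ →ₗ[ℝ] ℂ where
  toFun P := fourierT (toComplexFun (polyGauss P)) ξ
  map_add' P Q := by
    rw [← fourierT_add (integrable_toComplexFun (integrable_polyGauss P))
      (integrable_toComplexFun (integrable_polyGauss Q))]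
    congr 1
    ext x
    simp [toComplexFun, polyGauss, polyVal_add]
    ring
  map_smul' c P := by
    rw [RingHom.id_apply, Complex.real_smul, ← fourierT_const_mul]
    congr 1
    ext x
    simp [toComplexFun, polyGauss, polyVal_smul]
    ring

lemma gaussFT_apply (ξ : Rd d) (P : MvPolynomial (Fin d) ℝ) :
    gaussFT ξ P = fourierT (toComplexFun (polyGauss P)) ξ := rfl

/-- Integration by parts: multiplication by `x_i` under the transform lowers the degree, up to
multiplication by `ξ_i`. -/
lemma gaussFT_X_mul (ξ : Rd d) (i : Fin d) (P : MvPolynomial (Fin d) ℝ) :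
    gaussFT ξ (X i * P) = gaussFT ξ (pderiv i P) - Complex.I * ξ i * gaussFT ξ P := by
  have he : ∀ x : Rd d, HasLineDerivAt ℝ
      (fun x : Rd d => Complex.exp (-(Complex.I * ((inner ℝ ξ x : ℝ) : ℂ))))
      (Complex.exp (-(Complex.I * ((inner ℝ ξ x : ℝ) : ℂ))) * (-(Complex.I * ξ i))) x
      (EuclideanSpace.single i 1) := by
    intro x
    unfold HasLineDerivAt
    have h1 : HasDerivAt (fun t : ℝ => inner ℝ ξ (x + t • EuclideanSpace.single i (1 : ℝ)))
        (ξ i) 0 := by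
      have := ((hasDerivAt_id (0 : ℝ)).mul_const (ξ i)).const_add (inner ℝ ξ x)
      rw [one_mul] at this
      refine this.congr_of_eventuallyEq (.of_forall fun t => ?_)
      simp [inner_add_right, inner_smul_right, EuclideanSpace.inner_single_right]
    have h2 := ((h1.ofReal_comp.const_mul Complex.I).neg).cexp
    simpa using! h2
  have hparts := integral_bilinear_hasLineDerivAt_right_eq_neg_left_of_integrable
    (μ := (volume : Measure (Rd d))) (B := ContinuousLinearMap.lsmul ℝ ℝ (E := ℂ))
    (f := polyGauss P) (f' := polyGauss (pderiv i P - X i * P))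
    (g := fun x : Rd d => Complex.exp (-(Complex.I * ((inner ℝ ξ x : ℝ) : ℂ))))
    (g' := fun x : Rd d => Complex.exp (-(Complex.I * ((inner ℝ ξ x : ℝ) : ℂ))) *
      (-(Complex.I * ξ i))) (v := EuclideanSpace.single i 1)
    (by simpa using integrable_mul_fourierKernel (integrable_polyGauss _).ofReal ξ)
    (by simpa [mul_assoc] using
      ((integrable_mul_fourierKernel (integrable_polyGauss P).ofReal ξ).mul_const
        (-(Complex.I * ξ i))))
    (by simpa using integrable_mul_fourierKernel (integrable_polyGauss P).ofReal ξ)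
    (fun x _ => hasLineDerivAt_polyGauss P i x) (fun x _ => he x)
  simp only [ContinuousLinearMap.lsmul_apply, Complex.real_smul, ← mul_assoc] at hparts
  rw [integral_mul_const] at hparts
  have h := congrArg (fun z : ℂ => ((1 / (2 * Real.pi) ^ ((d : ℝ) / 2) : ℝ) : ℂ) * z) hparts
  have h3 : gaussFT ξ P * (-(Complex.I * ξ i)) = - gaussFT ξ (pderiv i P - X i * P) := by
    simp only [gaussFT_apply, fourierT, toComplexFun, mul_assoc] at h ⊢
    rw [h]; ring
  rw [map_sub] at h3
  linear_combination -h3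

lemma gaussFT_one (ξ : Rd d) : gaussFT ξ 1 = Real.exp (-‖ξ‖ ^ 2 / 2) := by
  have h := GaussianFourier.integral_cexp_neg_mul_sq_norm_add (V := Rd d) (b := (1 / 2 : ℂ))
    (by norm_num) (-Complex.I) ξ
  have hpi : (0 : ℝ) ≤ 2 * Real.pi := by positivity
  have hpi' : (0 : ℝ) < 2 * Real.pi := by positivity
  have e1 : ((Real.pi : ℂ) / (1 / 2)) ^ ((Module.finrank ℝ (Rd d) : ℂ) / 2) =
      (((2 * Real.pi) ^ ((d : ℝ) / 2) : ℝ) : ℂ) := by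
    rw [Complex.ofReal_cpow hpi]
    simp
    ring_nf
  rw [e1] at h
  rw [gaussFT_apply, fourierT]
  have e2 : ∫ x : Rd d, toComplexFun (polyGauss 1) x *
      Complex.exp (-(Complex.I * ((inner ℝ ξ x : ℝ) : ℂ))) =
      ∫ v : Rd d, Complex.exp (-(1 / 2) * (‖v‖ : ℂ) ^ 2 + -Complex.I * ((inner ℝ ξ v : ℝ) : ℂ)) := by
    congr 1
    ext v
    rw [Complex.exp_add]
    simp [toComplexFun, polyGauss, polyVal]
    ring_nf
  rw [e2, h, ← mul_assoc, ← Complex.ofReal_mul, one_div, inv_mul_cancel₀ (by positivity)]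
  simp
  ring_nf

/-- Euler's identity turned into a recursion for the transform of a homogeneous polynomial. -/
lemma gaussFT_euler (ξ : Rd d) {m : ℕ} {P : MvPolynomial (Fin d) ℝ} (hP : P.IsHomogeneous m) :
    (m : ℂ) * gaussFT ξ P = gaussFT ξ (polyLaplacian d P) -
      Complex.I * ∑ i, (ξ i : ℂ) * gaussFT ξ (pderiv i P) := by
  have h : (m : ℂ) * gaussFT ξ P = gaussFT ξ (m • P) := by rw [map_nsmul, nsmul_eq_mul]
  rw [h, ← hP.sum_X_mul_pderiv, map_sum, polyLaplacian_apply, map_sum, mul_sum,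
    ← sum_sub_distrib]
  exact sum_congr rfl fun i _ => by rw [gaussFT_X_mul]; ring

/-- A harmonic homogeneous polynomial times the Gaussian is an eigenfunction of the Fourier
transform. -/
lemma gaussFT_harmonic (ξ : Rd d) {n : ℕ} {P : MvPolynomial (Fin d) ℝ}
    (hP : P ∈ harmonicPoly d n) :
    gaussFT ξ P = (-Complex.I) ^ n * (polyGauss P ξ : ℂ) := by
  induction n generalizing P with
  | zero =>
    obtain ⟨c, rfl⟩ : ∃ c, P = C c := by
      have := (mem_harmonicPoly.mp hP).1
      exact ⟨_, totalDegree_eq_zero_iff_eq_C.mp (by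
        simpa using this.totalDegree_le)⟩
    rw [← mul_one (C c), ← smul_eq_C_mul, map_smul, gaussFT_one]
    simp [polyGauss, polyVal]
  | succ n ih =>
    obtain ⟨hh, hΔ⟩ := mem_harmonicPoly.mp hP
    have h1 := gaussFT_euler ξ hh
    have h2 : ∀ i, gaussFT ξ (pderiv i P) = (-Complex.I) ^ n * (polyGauss (pderiv i P) ξ : ℂ) :=
      fun i => ih (pderiv_mem_harmonicPoly hP i)
    have h3 : ∑ i, ξ i * polyGauss (pderiv i P) ξ = (n + 1) * polyGauss P ξ := by
      have := congrArg (fun Q => polyVal Q ξ * Real.exp (-‖ξ‖ ^ 2 / 2)) hh.sum_X_mul_pderiv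
      simp only [polyVal, map_sum, map_mul, eval_X, sum_mul, map_nsmul] at this
      simp only [polyGauss, polyVal]
      rw [sum_congr rfl fun i _ => (mul_assoc (ξ i) _ _).symm, this]
      simp
      ring
    have h4 : ∑ i, (ξ i : ℂ) * gaussFT ξ (pderiv i P) =
        (-Complex.I) ^ n * ((n + 1) * (polyGauss P ξ : ℂ)) := by
      have h3' := congrArg (fun r : ℝ => (r : ℂ)) h3
      push_cast at h3'
      rw [← h3', mul_sum]
      exact sum_congr rfl fun i _ => by rw [h2]; ring
    rw [hΔ, map_zero, h4] at h1
    have hn : ((n + 1 : ℕ) : ℂ) ≠ 0 := by exact_mod_cast n.succ_ne_zero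
    refine mul_left_cancel₀ hn ?_
    rw [h1]
    push_cast
    ring

/-- The transform of `|x|² P`, for `P` homogeneous. -/
lemma gaussFT_normSqPoly_mul (ξ : Rd d) {m : ℕ} {P : MvPolynomial (Fin d) ℝ}
    (hP : P.IsHomogeneous m) :
    gaussFT ξ (normSqPoly d * P) =
      (d + 2 * m - (‖ξ‖ : ℂ) ^ 2) * gaussFT ξ P - gaussFT ξ (polyLaplacian d P) := by
  have hE := gaussFT_euler ξ hP
  have hm : ∑ i, gaussFT ξ (X i * pderiv i P) = m * gaussFT ξ P := by
    rw [← map_sum, hP.sum_X_mul_pderiv, map_nsmul, nsmul_eq_mul]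
  have hx : ∑ i, (ξ i : ℂ) * ξ i = (‖ξ‖ : ℂ) ^ 2 := by
    rw [← Complex.ofReal_pow, EuclideanSpace.norm_sq_eq]
    simp [pow_two]
  have hi : ∀ i, gaussFT ξ (X i * X i * P) = gaussFT ξ P + gaussFT ξ (X i * pderiv i P) -
      Complex.I * ((ξ i : ℂ) * gaussFT ξ (pderiv i P)) - (ξ i : ℂ) * ξ i * gaussFT ξ P := by
    intro i
    rw [mul_assoc, gaussFT_X_mul, gaussFT_X_mul]
    simp only [Derivation.leibniz, pderiv_X_self, smul_eq_mul, mul_one, map_add]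
    linear_combination (ξ i : ℂ) * ξ i * gaussFT ξ P * Complex.I_mul_I
  simp only [normSqPoly, sum_mul, map_sum, hi]
  simp only [sum_sub_distrib, sum_add_distrib, hm, ← mul_sum, ← sum_mul, hx]
  simp
  linear_combination -hE

/-- The transform of `|x|^{2j} P`, for `P` harmonic; the recursion obtained from Euler's identity
is the three-term recurrence of `2^j j! L_j^{(α)}(|ξ|²/2)`. -/
lemma gaussFT_normSqPoly_pow_mul (ξ : Rd d) {n : ℕ} {P : MvPolynomial (Fin d) ℝ}
    (hP : P ∈ harmonicPoly d n) (j : ℕ) :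
    gaussFT ξ (normSqPoly d ^ j * P) = (-Complex.I) ^ n *
      ((2 ^ j * j.factorial * genLaguerre j (n + ((d : ℝ) - 2) / 2) (‖ξ‖ ^ 2 / 2) *
        polyGauss P ξ : ℝ) : ℂ) := by
  have hh := (mem_harmonicPoly.mp hP).1
  have hrec : ∀ j : ℕ, gaussFT ξ (normSqPoly d ^ (j + 1) * P) =
      (d + 2 * (2 * j + n) - (‖ξ‖ : ℂ) ^ 2) * gaussFT ξ (normSqPoly d ^ j * P) -
      ((4 * j * (j + (n + ((d : ℝ) - 2) / 2)) : ℝ) : ℂ) *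
        gaussFT ξ (normSqPoly d ^ (j - 1) * P) := by
    intro j
    rw [pow_succ', mul_assoc, gaussFT_normSqPoly_mul ξ (isHomogeneous_normSqPoly_pow_mul hh j),
      polyLaplacian_normSqPoly_pow_mul hP, map_smul, Complex.real_smul]
    push_cast
    ring
  induction j using Nat.twoStepInduction with
  | zero =>
    simp [genLaguerre, risingFactorial_zero, gaussFT_harmonic ξ hP]
  | one =>
    rw [hrec 0, pow_zero, one_mul, gaussFT_harmonic ξ hP]
    simp [genLaguerre, sum_range_succ, risingFactorial_succ, risingFactorial_zero]
    ring
  | more j ih1 ih2 =>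
    have hL := genLaguerre_succ_succ j (n + ((d : ℝ) - 2) / 2) (‖ξ‖ ^ 2 / 2)
    have hL' := congrArg (fun r : ℝ => (r : ℂ)) hL
    rw [hrec (j + 1), Nat.add_sub_cancel, ih1, ih2]
    simp only [Nat.factorial_succ, pow_succ] at hL' ⊢
    push_cast at hL' ⊢
    linear_combination (-Complex.I) ^ n * (2 : ℂ) ^ j * 4 * (j + 1) * j.factorial *
      (polyGauss P ξ : ℂ) * (-hL')

end GaussianFourier

/-! ### Fourier transforms of the generalised Hermite functions -/

section HermiteTransform

variable {d : ℕ}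

open MvPolynomial Finset

lemma polyGauss_smul (c : ℝ) (P : MvPolynomial (Fin d) ℝ) (x : Rd d) :
    polyGauss (c • P) x = c * polyGauss P x := by
  rw [polyGauss, polyGauss, polyVal_smul, mul_assoc]

lemma polyGauss_sum {ι : Type*} (s : Finset ι) (P : ι → MvPolynomial (Fin d) ℝ) (x : Rd d) :
    polyGauss (∑ i ∈ s, P i) x = ∑ i ∈ s, polyGauss (P i) x := by
  simp [polyGauss, polyVal, sum_mul]

lemma polyGauss_normSqPoly_pow_mul (P : MvPolynomial (Fin d) ℝ) (j : ℕ) (x : Rd d) :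
    polyGauss (normSqPoly d ^ j * P) x = (‖x‖ ^ 2) ^ j * polyGauss P x := by
  rw [polyGauss, polyGauss, polyVal_mul, polyVal_pow, polyVal_normSqPoly, mul_assoc]

/-- The polynomial factor of the GHF `Ĥ_{k,ℓ}^{μ,n}`, including the normalisation. -/
def hermiteMvPoly (μ : ℝ) (n k : ℕ) (P : MvPolynomial (Fin d) ℝ) : MvPolynomial (Fin d) ℝ :=
  √(1 / hermiteGamma d μ n k) •
    ∑ i ∈ range (k + 1), laguerreCoeff k (n + ((d : ℝ) - 2) / 2 + μ) i • (normSqPoly d ^ i * P)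

lemma polyGauss_hermiteMvPoly (μ : ℝ) (n k : ℕ) (P : MvPolynomial (Fin d) ℝ) (x : Rd d) :
    polyGauss (hermiteMvPoly μ n k P) x = genHermiteFun μ n k P x := by
  simp only [hermiteMvPoly, polyGauss_smul, polyGauss_sum, polyGauss_normSqPoly_pow_mul,
    genHermiteFun, genHermitePoly, genLaguerre_eq_sum, sum_mul, mul_sum]
  refine sum_congr rfl fun i _ => ?_
  rw [polyGauss]
  ring

lemma genHermiteFun_eq_polyGauss (μ : ℝ) (n k : ℕ) (P : MvPolynomial (Fin d) ℝ) :
    genHermiteFun μ n k P = polyGauss (hermiteMvPoly μ n k P) :=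
  funext fun x => (polyGauss_hermiteMvPoly μ n k P x).symm

lemma adjHermiteFun_eq_polyGauss (μ : ℝ) (n k : ℕ) (P : MvPolynomial (Fin d) ℝ) :
    adjHermiteFun μ n k P = polyGauss (∑ j ∈ range (k + 1),
      ((-1) ^ (k - j) * connectionCoeff d n μ 0 k j) • hermiteMvPoly 0 n j P) := by
  ext x
  simp only [polyGauss_sum, polyGauss_smul, polyGauss_hermiteMvPoly, adjHermiteFun]

/-- The GHFs with `μ = 0`, the classical Hermite functions in spherical form, are eigenfunctions
of the Fourier transform. -/
lemma gaussFT_hermiteMvPoly_zero (ξ : Rd d) {n : ℕ} {P : MvPolynomial (Fin d) ℝ}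
    (hP : P ∈ harmonicPoly d n) (k : ℕ) :
    gaussFT ξ (hermiteMvPoly 0 n k P) =
      (-Complex.I) ^ (n + 2 * k) * (genHermiteFun 0 n k P ξ : ℂ) := by
  have hs := sum_laguerreCoeff_mul_genLaguerre_half k (n + ((d : ℝ) - 2) / 2) (‖ξ‖ ^ 2)
  have hI : (-Complex.I) ^ (n + 2 * k) = (-Complex.I) ^ n * (((-1) ^ k : ℝ) : ℂ) := by
    rw [pow_add, pow_mul]
    simp
  simp only [hermiteMvPoly, map_smul, map_sum, gaussFT_normSqPoly_pow_mul ξ hP, add_zero]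
  have h2 : ∑ i ∈ range (k + 1), laguerreCoeff k (n + ((d : ℝ) - 2) / 2) i •
      ((-Complex.I) ^ n * ((2 ^ i * i.factorial *
        genLaguerre i (n + ((d : ℝ) - 2) / 2) (‖ξ‖ ^ 2 / 2) * polyGauss P ξ : ℝ) : ℂ)) =
      (-Complex.I) ^ n * (((∑ i ∈ range (k + 1), laguerreCoeff k (n + ((d : ℝ) - 2) / 2) i *
        (2 ^ i * i.factorial * genLaguerre i (n + ((d : ℝ) - 2) / 2) (‖ξ‖ ^ 2 / 2))) *
          polyGauss P ξ : ℝ) : ℂ) := by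
    rw [sum_mul, Complex.ofReal_sum, mul_sum]
    refine sum_congr rfl fun i _ => ?_
    rw [Complex.real_smul]
    push_cast
    ring
  rw [h2, hs, hI, Complex.real_smul, genHermiteFun, genHermitePoly, polyGauss, add_zero]
  push_cast
  ring

lemma hermite_Gamma_arg_pos (hd : 1 ≤ d) {μ : ℝ} (hμ : -1 / 2 < μ) (n k : ℕ) :
    0 < (k : ℝ) + n + (d : ℝ) / 2 + μ := by
  have h1 : (1 : ℝ) ≤ d := by exact_mod_cast hd
  have h2 : (0 : ℝ) ≤ k := k.cast_nonneg
  have h3 : (0 : ℝ) ≤ n := n.cast_nonneg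
  linarith

/-- The GHF of parameter `μ` is the combination of the Hermite functions with `μ = 0` given by
the connection coefficients. -/
lemma genHermiteFun_eq_sum (hd : 1 ≤ d) {μ : ℝ} (hμ : -1 / 2 < μ) (n k : ℕ)
    (P : MvPolynomial (Fin d) ℝ) (x : Rd d) :
    genHermiteFun μ n k P x =
      ∑ j ∈ range (k + 1), connectionCoeff d n μ 0 k j * genHermiteFun 0 n j P x := by
  have hn : ∀ j : ℕ, √(k.factorial * Real.Gamma (j + n + (d : ℝ) / 2 + 0) /
      (j.factorial * Real.Gamma (k + n + (d : ℝ) / 2 + μ))) * √(1 / hermiteGamma d 0 n j) =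
      √(1 / hermiteGamma d μ n k) := by
    intro j
    have h1 := Real.Gamma_pos_of_pos (hermite_Gamma_arg_pos hd hμ n k)
    have h2 := Real.Gamma_pos_of_pos (hermite_Gamma_arg_pos hd (μ := 0) (by norm_num) n j)
    rw [← Real.sqrt_mul (by positivity)]
    congr 1
    rw [hermiteGamma, hermiteGamma]
    field_simp
  rw [genHermiteFun, genHermitePoly, genLaguerre_add, sum_mul, mul_sum]
  refine sum_congr rfl fun j _ => ?_
  rw [connectionCoeff, genHermiteFun, genHermitePoly, ← hn j]
  simp only [sub_zero, add_zero]
  ring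

lemma neg_one_pow_sub_mul_neg_I_pow (n : ℕ) {j k : ℕ} (h : j ≤ k) :
    ((-1 : ℂ)) ^ (k - j) * (-Complex.I) ^ (n + 2 * j) = (-Complex.I) ^ (n + 2 * k) := by
  obtain ⟨m, rfl⟩ := Nat.exists_eq_add_of_le h
  have h1 : (-Complex.I) ^ (2 * m) = (-1) ^ m := by
    rw [pow_mul]; simp
  rw [Nat.add_sub_cancel_left, ← h1, ← pow_add]
  congr 1
  ring

lemma fourierT_adjHermiteFun (hd : 1 ≤ d) {μ : ℝ} (hμ : -1 / 2 < μ) {n : ℕ}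
    {P : MvPolynomial (Fin d) ℝ} (hP : P ∈ harmonicPoly d n) (k : ℕ) (ξ : Rd d) :
    fourierT (toComplexFun (adjHermiteFun μ n k P)) ξ =
      (-Complex.I) ^ (n + 2 * k) * (genHermiteFun μ n k P ξ : ℂ) := by
  rw [adjHermiteFun_eq_polyGauss, ← gaussFT_apply, map_sum, genHermiteFun_eq_sum hd hμ,
    Complex.ofReal_sum, mul_sum]
  refine sum_congr rfl fun j hj => ?_
  rw [map_smul, gaussFT_hermiteMvPoly_zero ξ hP,
    ← neg_one_pow_sub_mul_neg_I_pow n (Nat.lt_succ_iff.mp (mem_range.mp hj)), Complex.real_smul]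
  push_cast
  ring

/-- `fourierT_adjHermiteFun` with the roles of the GHF and the A-GHF exchanged; its complex conjugate
is the inverse transform of the GHF. -/
lemma fourierT_genHermiteFun (hd : 1 ≤ d) {μ : ℝ} (hμ : -1 / 2 < μ) {n : ℕ}
    {P : MvPolynomial (Fin d) ℝ} (hP : P ∈ harmonicPoly d n) (k : ℕ) (ξ : Rd d) :
    fourierT (toComplexFun (genHermiteFun μ n k P)) ξ =
      (-Complex.I) ^ (n + 2 * k) * (adjHermiteFun μ n k P ξ : ℂ) := by
  have e : genHermiteFun μ n k P = polyGauss (∑ j ∈ range (k + 1),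
      connectionCoeff d n μ 0 k j • hermiteMvPoly 0 n j P) := by
    ext x
    simp only [genHermiteFun_eq_sum hd hμ, polyGauss_sum, polyGauss_smul, polyGauss_hermiteMvPoly]
  rw [e, ← gaussFT_apply, map_sum, adjHermiteFun, Complex.ofReal_sum, mul_sum]
  refine sum_congr rfl fun j hj => ?_
  have hs : ((-1 : ℂ)) ^ (k - j) * (-1) ^ (k - j) = 1 := by rw [← mul_pow]; norm_num
  rw [map_smul, gaussFT_hermiteMvPoly_zero ξ hP,
    ← neg_one_pow_sub_mul_neg_I_pow n (Nat.lt_succ_iff.mp (mem_range.mp hj)), Complex.real_smul]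
  push_cast
  linear_combination -((connectionCoeff d n μ 0 k j : ℂ) * (-Complex.I) ^ (n + 2 * j) *
    (genHermiteFun 0 n j P ξ : ℂ)) * hs

end HermiteTransform

/-! ### Fourier inversion and Parseval in the symmetric normalisation -/

section FourierInversion

variable {d : ℕ}

open FourierTransform

lemma conj_fourierTInv (v : Rd d → ℂ) (x : Rd d) :
    (starRingEnd ℂ) (fourierTInv v x) = fourierT (fun ξ => (starRingEnd ℂ) (v ξ)) x := by
  rw [fourierTInv, fourierT, map_mul, Complex.conj_ofReal, ← integral_conj]
  simp [← Complex.exp_conj, real_inner_comm]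

lemma fourierTInv_eq_fourierT_neg (v : Rd d → ℂ) (x : Rd d) :
    fourierTInv v x = fourierT v (-x) := by
  simp [fourierTInv, fourierT, real_inner_comm]

lemma fourierTInv_toComplexFun (v : Rd d → ℝ) (x : Rd d) :
    fourierTInv (toComplexFun v) x = (starRingEnd ℂ) (fourierT (toComplexFun v) x) := by
  rw [← Complex.conj_conj (fourierTInv _ _), conj_fourierTInv]
  simp only [toComplexFun, Complex.conj_ofReal]
  rfl

lemma fourierT_eq_fourier (u : Rd d → ℂ) (ξ : Rd d) :
    fourierT u ξ = ((1 / (2 * Real.pi) ^ ((d : ℝ) / 2) : ℝ) : ℂ) *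
      𝓕 u ((2 * Real.pi)⁻¹ • ξ) := by
  rw [fourierT, Real.fourier_eq']
  congr 2
  ext x
  rw [smul_eq_mul, mul_comm, inner_smul_right, real_inner_comm]
  congr 2
  have : (Real.pi : ℂ) ≠ 0 := by exact_mod_cast Real.pi_ne_zero
  push_cast
  field_simp

lemma fourierTInv_eq_fourierInv (u : Rd d → ℂ) (ξ : Rd d) :
    fourierTInv u ξ = ((1 / (2 * Real.pi) ^ ((d : ℝ) / 2) : ℝ) : ℂ) *
      𝓕⁻ u ((2 * Real.pi)⁻¹ • ξ) := by
  rw [fourierTInv_eq_fourierT_neg, fourierT_eq_fourier, Real.fourierInv_eq_fourier_neg, smul_neg]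

lemma continuous_fourierT {u : Rd d → ℂ} (hu : Integrable u) : Continuous (fourierT u) := by
  have h : Continuous (𝓕 u) := VectorFourier.fourierIntegral_continuous Real.continuous_fourierChar
      (by exact continuous_inner) hu
  have e : fourierT u = fun ξ => ((1 / (2 * Real.pi) ^ ((d : ℝ) / 2) : ℝ) : ℂ) *
      𝓕 u ((2 * Real.pi)⁻¹ • ξ) := funext (fourierT_eq_fourier u)
  rw [e]
  fun_prop

/-- Fourier inversion in the symmetric normalisation. -/
lemma fourierT_fourierTInv {f : Rd d → ℂ} (hc : Continuous f) (hf : Integrable f)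
    (hF : Integrable (fourierTInv f)) (ξ : Rd d) : fourierT (fourierTInv f) ξ = f ξ := by
  have h2pi : (0 : ℝ) < 2 * Real.pi := by positivity
  set c : ℝ := 1 / (2 * Real.pi) ^ ((d : ℝ) / 2) with hc'
  have hcc : c * c * (2 * Real.pi) ^ d = 1 := by
    rw [hc', ← Real.rpow_natCast, div_mul_div_comm, one_mul, ← Real.rpow_add h2pi, add_halves,
      one_div, inv_mul_cancel₀ (Real.rpow_pos_of_pos h2pi _).ne']
  have hcpos : 0 < c := by positivity
  have hI : Integrable (𝓕⁻ f) := by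
    have h1 : Integrable (fun x : Rd d => 𝓕⁻ f ((2 * Real.pi)⁻¹ • x)) := by
      have := hF.const_mul ((c⁻¹ : ℝ) : ℂ)
      refine this.congr (.of_forall fun x => ?_)
      simp only [fourierTInv_eq_fourierInv]
      rw [← hc', ← mul_assoc, ← Complex.ofReal_mul, inv_mul_cancel₀ hcpos.ne', Complex.ofReal_one,
        one_mul]
    exact (integrable_comp_smul_iff volume _ (inv_ne_zero h2pi.ne')).mp h1
  have hI' : Integrable (𝓕 f) := by
    refine hI.comp_neg.congr (.of_forall fun x => ?_)
    simp only [Real.fourierInv_eq_fourier_neg, neg_neg]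
  have hinv := congrFun (hc.fourier_fourierInv_eq hf hI') ξ
  rw [Real.fourier_eq'] at hinv
  rw [fourierT]
  have e : (fun x : Rd d => fourierTInv f x * Complex.exp (-(Complex.I * ((inner ℝ ξ x : ℝ) : ℂ)))) =
      fun x : Rd d => (c : ℂ) * (fun v : Rd d => Complex.exp (↑(-2 * Real.pi * inner ℝ v ξ) * Complex.I) •
        𝓕⁻ f v) ((2 * Real.pi)⁻¹ • x) := by
    ext x
    simp only [fourierTInv_eq_fourierInv]
    rw [smul_eq_mul, real_inner_smul_left, real_inner_comm ξ x, mul_assoc, mul_comm (𝓕⁻ f _)]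
    congr 3
    have : (Real.pi : ℂ) ≠ 0 := by exact_mod_cast Real.pi_ne_zero
    push_cast
    field_simp
  rw [e, integral_const_mul, Measure.integral_comp_inv_smul volume (fun v : Rd d =>
    Complex.exp (↑(-2 * Real.pi * inner ℝ v ξ) * Complex.I) • 𝓕⁻ f v), hinv, finrank_euclideanSpace_fin,
    abs_of_pos (by positivity), Complex.real_smul, ← hc', ← mul_assoc, ← mul_assoc,
    ← Complex.ofReal_mul, ← Complex.ofReal_mul, hcc, Complex.ofReal_one, one_mul]

/-- The Fourier transform can be moved from one factor of an integral to the other. -/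
lemma integral_fourierT_mul {u v : Rd d → ℂ} (hu : Integrable u) (hv : Integrable v) :
    ∫ x, fourierT u x * v x = ∫ x, u x * fourierT v x := by
  have h := VectorFourier.integral_fourierIntegral_smul_eq_flip (μ := volume) (ν := volume)
    (L := (2 * Real.pi)⁻¹ • innerₗ (Rd d)) (e := Real.fourierChar) Real.continuous_fourierChar
    (by
      have : Continuous fun p : Rd d × Rd d => (2 * Real.pi)⁻¹ * inner ℝ p.1 p.2 := by fun_prop
      simpa using! this) hu hv
  have hpi : (Real.pi : ℂ) ≠ 0 := by exact_mod_cast Real.pi_ne_zero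
  have e1 : ∀ (w : Rd d → ℂ) (x : Rd d), fourierT w x =
      ((1 / (2 * Real.pi) ^ ((d : ℝ) / 2) : ℝ) : ℂ) *
      VectorFourier.fourierIntegral Real.fourierChar volume ((2 * Real.pi)⁻¹ • innerₗ (Rd d)) w x := by
    intro w x
    rw [fourierT, VectorFourier.fourierIntegral]
    congr 2
    ext y
    rw [Circle.smul_def, Real.fourierChar_apply, smul_eq_mul, mul_comm]
    congr 2
    simp only [LinearMap.smul_apply, innerₗ_apply_apply, smul_eq_mul]
    rw [real_inner_comm]
    push_cast
    field_simp
  have e2 : ((2 * Real.pi)⁻¹ • innerₗ (Rd d)).flip = (2 * Real.pi)⁻¹ • innerₗ (Rd d) := by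
    ext x y
    simp [real_inner_comm]
  rw [e2] at h
  simp only [smul_eq_mul] at h
  simp only [e1, mul_assoc, mul_left_comm _ ((1 / (2 * Real.pi) ^ ((d : ℝ) / 2) : ℝ) : ℂ)]
  rw [integral_const_mul, integral_const_mul, h]

/-- Parseval's identity for functions whose inverse transform is integrable. -/
lemma innerRd_fourierTInv {f g : Rd d → ℂ} (hc : Continuous f) (hf : Integrable f)
    (hF : Integrable (fourierTInv f)) (hg : Integrable g) :
    innerRd (fourierTInv f) (fourierTInv g) = ∫ ξ, f ξ * (starRingEnd ℂ) (g ξ) := by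
  have hg' : Integrable (fun ξ => (starRingEnd ℂ) (g ξ)) :=
    Complex.conjCLE.integrable_comp_iff.mpr hg
  rw [innerRd]
  simp only [conj_fourierTInv]
  rw [← integral_fourierT_mul hF hg']
  simp only [fourierT_fourierTInv hc hf hF]

/-- An integrable function that is the inverse transform of an integrable function is bounded, hence
square integrable. -/
lemma memLp_two_fourierTInv {f : Rd d → ℂ} (hF : Integrable (fourierTInv f)) :
    MemLp (fourierTInv f) 2 := by
  rw [memLp_two_iff_integrable_sq_norm hF.1]
  have hb : ∀ x, ‖‖fourierTInv f x‖‖ ≤ 1 / (2 * Real.pi) ^ ((d : ℝ) / 2) * ∫ ξ, ‖f ξ‖ := by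
    intro x
    rw [norm_norm, fourierTInv_eq_fourierT_neg, fourierT, norm_mul, Complex.norm_real,
      Real.norm_of_nonneg (by positivity)]
    gcongr
    refine (norm_integral_le_integral_norm _).trans (le_of_eq ?_)
    congr 1
    ext ξ
    rw [norm_mul, norm_fourierKernel, mul_one]
  simpa [pow_two] using hF.norm.bdd_mul hF.norm.aestronglyMeasurable (.of_forall hb)

end FourierInversion

/-! ### Fractional powers times Hermite functions -/

section FractionalPower

variable {d : ℕ}

open MvPolynomial Set

/-- The weight of the superposition is integrable: it is at most `r^{t-1}` near `0` and at most
`r^{t-1-m}` near infinity. -/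
lemma integrableOn_rpow_mul_inv_sqrt_pow {t : ℝ} (ht : 0 < t) {m N : ℕ} (hm : t < m)
    (hN : 2 * m ≤ N) :
    IntegrableOn (fun r : ℝ => r ^ (t - 1) * (√(1 + 2 * r) ^ N)⁻¹) (Ioi 0) := by
  have hmeas : Measurable (fun r : ℝ => r ^ (t - 1) * (√(1 + 2 * r) ^ N)⁻¹) := by fun_prop
  have hone : ∀ r : ℝ, 0 < r → 1 ≤ √(1 + 2 * r) := fun r hr => by
    rw [Real.one_le_sqrt]; linarith
  have hsplit : Ioi (0 : ℝ) = Ioc 0 1 ∪ Ioi 1 := (Ioc_union_Ioi_eq_Ioi zero_le_one).symm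
  rw [hsplit, integrableOn_union]
  constructor
  · have h1 : IntegrableOn (fun r : ℝ => r ^ (t - 1)) (Ioc 0 1) := by
      rw [← intervalIntegrable_iff_integrableOn_Ioc_of_le zero_le_one]
      exact intervalIntegral.intervalIntegrable_rpow' (by linarith)
    refine h1.mono' hmeas.aestronglyMeasurable ?_
    filter_upwards [ae_restrict_mem measurableSet_Ioc] with r hr
    have h2 := one_le_pow₀ (n := N) (hone r hr.1)
    have h3 : 0 ≤ r ^ (t - 1) := Real.rpow_nonneg hr.1.le _
    rw [Real.norm_of_nonneg (by positivity)]
    exact mul_le_of_le_one_right h3 (inv_le_one_of_one_le₀ h2)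
  · have h1 : IntegrableOn (fun r : ℝ => r ^ (t - 1 - m)) (Ioi 1) :=
      integrableOn_Ioi_rpow_of_lt (by linarith) zero_lt_one
    refine h1.mono' hmeas.aestronglyMeasurable ?_
    filter_upwards [ae_restrict_mem measurableSet_Ioi] with r hr
    have hr0 : 0 < r := zero_lt_one.trans hr
    have h2 : r ^ m ≤ √(1 + 2 * r) ^ N := by
      calc r ^ m ≤ (1 + 2 * r) ^ m := by gcongr; linarith
        _ = √(1 + 2 * r) ^ (2 * m) := by rw [pow_mul, Real.sq_sqrt (by linarith)]
        _ ≤ _ := pow_le_pow_right₀ (hone r hr0) hN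
    have h3 : 0 ≤ r ^ (t - 1) := Real.rpow_nonneg hr0.le _
    rw [Real.norm_of_nonneg (by positivity), Real.rpow_sub hr0 _ (m : ℝ), Real.rpow_natCast,
      div_eq_mul_inv]
    gcongr

/-- A Gaussian factor `e^{-r|x|²}` acts on a homogeneous polynomial times `e^{-|x|²/2}`
as a dilation. -/
lemma exp_mul_polyGauss {N : ℕ} {Q : MvPolynomial (Fin d) ℝ} (hQ : Q.IsHomogeneous N) {r : ℝ}
    (hr : 0 < r) (x : Rd d) :
    Real.exp (-(r * ‖x‖ ^ 2)) * polyGauss Q x =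
      (√(1 + 2 * r) ^ N)⁻¹ * polyGauss Q (√(1 + 2 * r) • x) := by
  have hb : 0 < √(1 + 2 * r) := Real.sqrt_pos.mpr (by linarith)
  rw [polyGauss, polyGauss, polyVal_const_smul hQ, norm_smul, mul_pow, Real.norm_eq_abs, sq_abs,
    Real.sq_sqrt (by linarith), mul_assoc, inv_mul_cancel_left₀ (by positivity), mul_left_comm,
    ← Real.exp_add]
  congr 2
  ring

lemma fourierT_comp_smul (u : Rd d → ℂ) {b : ℝ} (hb : 0 < b) (ξ : Rd d) :
    fourierT (fun x => u (b • x)) ξ = ((b ^ d)⁻¹ : ℝ) * fourierT u (b⁻¹ • ξ) := by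
  have e : ∀ x : Rd d, u (b • x) * Complex.exp (-(Complex.I * ((inner ℝ ξ x : ℝ) : ℂ))) =
      (fun y => u y * Complex.exp (-(Complex.I * ((inner ℝ (b⁻¹ • ξ) y : ℝ) : ℂ)))) (b • x) := by
    intro x
    simp only [real_inner_smul_left, real_inner_smul_right, mul_inv_cancel_left₀ hb.ne']
  simp only [fourierT]
  rw [integral_congr_ae (.of_forall e), Measure.integral_comp_smul volume (fun y : Rd d =>
    u y * Complex.exp (-(Complex.I * ((inner ℝ (b⁻¹ • ξ) y : ℝ) : ℂ)))), finrank_euclideanSpace_fin,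
    abs_of_pos (by positivity), Complex.real_smul]
  ring

/-- A superposition of dilates of an integrable function converges absolutely as soon as the weights,
corrected by the Jacobians of the dilations, are integrable. -/
lemma integrable_prod_dilation {w : ℝ → ℝ} {b : ℝ → ℝ} (hw : Measurable w) (hb : Measurable b)
    (hbpos : ∀ r, 0 < r → 0 < b r) (hwi : IntegrableOn (fun r => w r * (b r ^ d)⁻¹) (Ioi 0))
    {u : Rd d → ℂ} (hc : Continuous u) (hu : Integrable u) :
    Integrable (fun p : ℝ × Rd d => (w p.1 : ℂ) * u (b p.1 • p.2))
      ((volume.restrict (Ioi 0)).prod volume) := by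
  have hmeas : Measurable (fun p : ℝ × Rd d => (w p.1 : ℂ) * u (b p.1 • p.2)) := by
    have := hc.measurable
    fun_prop
  rw [integrable_prod_iff hmeas.aestronglyMeasurable]
  constructor
  · filter_upwards [ae_restrict_mem measurableSet_Ioi] with r hr
    exact (hu.comp_smul (hbpos r hr).ne').const_mul _
  · refine (hwi.norm.mul_const (∫ x, ‖u x‖)).congr ?_
    filter_upwards [ae_restrict_mem measurableSet_Ioi] with r hr
    have hb' := hbpos r hr
    simp only [norm_mul, Complex.norm_real]
    rw [integral_const_mul, Measure.integral_comp_smul volume (fun x => ‖u x‖),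
      finrank_euclideanSpace_fin, abs_of_pos (by positivity), smul_eq_mul,
      Real.norm_of_nonneg (by positivity : 0 ≤ (b r ^ d)⁻¹)]
    ring

/-- Subordination: for `m > s`, `|x|^{2s}` is `|x|^{2m}` times a superposition of Gaussians. -/
lemma rpow_mul_polyGauss_eq_integral {s : ℝ} {m : ℕ} (hm : s < m) (P : MvPolynomial (Fin d) ℝ)
    {x : Rd d} (hx : x ≠ 0) :
    ‖x‖ ^ (2 * s) * polyGauss P x = (Real.Gamma (m - s))⁻¹ *
      ∫ r in Ioi (0 : ℝ), r ^ (m - s - 1) *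
        (Real.exp (-(r * ‖x‖ ^ 2)) * polyGauss (normSqPoly d ^ m * P) x) := by
  have hx' : 0 < ‖x‖ := norm_pos_iff.mpr hx
  have ht : 0 < m - s := by linarith
  have h := Real.integral_rpow_mul_exp_neg_mul_Ioi ht (pow_pos hx' 2)
  have e : ∀ r : ℝ, r ^ (m - s - 1) *
        (Real.exp (-(r * ‖x‖ ^ 2)) * polyGauss (normSqPoly d ^ m * P) x) =
      r ^ (m - s - 1) * Real.exp (-(‖x‖ ^ 2 * r)) * polyGauss (normSqPoly d ^ m * P) x := by
    intro r
    rw [mul_comm r, mul_assoc]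
  simp only [e]
  rw [integral_mul_const, h, polyGauss_normSqPoly_pow_mul, one_div,
    Real.inv_rpow (by positivity), ← Real.rpow_natCast ‖x‖ 2, ← Real.rpow_mul hx'.le,
    ← Real.rpow_natCast _ m, ← Real.rpow_mul hx'.le, ← Real.rpow_neg hx'.le]
  have h2 : ‖x‖ ^ (2 * s) =
      ‖x‖ ^ (-(((2 : ℕ) : ℝ) * (m - s))) * ‖x‖ ^ (((2 : ℕ) : ℝ) * (m : ℝ)) := by
    rw [← Real.rpow_add hx']
    congr 1
    push_cast
    ring
  rw [h2]
  have hG := (Real.Gamma_pos_of_pos ht).ne'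
  field_simp

/-- The transform of `|ξ|^{2s}` times a Hermite function is integrable although `|ξ|^{2s}` is not
smooth at the origin: it is a superposition of dilates of one fixed integrable function. -/
lemma integrable_fourierT_rpow_mul_polyGauss (hd : 1 ≤ d) {n : ℕ} {P : MvPolynomial (Fin d) ℝ}
    (hP : P ∈ harmonicPoly d n) (j : ℕ) {s : ℝ} (hs : 0 < s) :
    Integrable (fourierT (toComplexFun fun ξ : Rd d =>
      ‖ξ‖ ^ (2 * s) * polyGauss (normSqPoly d ^ j * P) ξ)) := by
  -- Any integer `m > s` serves: the factor `|ξ|^{2m}` makes the weight integrable both at `0` and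
  -- at infinity.
  obtain ⟨m, hm⟩ := exists_nat_gt s
  set t : ℝ := m - s with ht_def
  have ht : 0 < t := by rw [ht_def]; linarith
  have htm : t < m := by rw [ht_def]; linarith
  have hhom := (mem_harmonicPoly.mp hP).1
  set Q : MvPolynomial (Fin d) ℝ := normSqPoly d ^ m * (normSqPoly d ^ j * P) with hQdef
  have hQ' : Q = normSqPoly d ^ (m + j) * P := by rw [hQdef, pow_add, mul_assoc]
  set N : ℕ := 2 * (m + j) + n
  have hQ : Q.IsHomogeneous N := by
    rw [hQ']; exact isHomogeneous_normSqPoly_pow_mul hhom _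
  set b : ℝ → ℝ := fun r => √(1 + 2 * r) with hb_def
  have hbpos : ∀ r, 0 < r → 0 < b r := fun r hr => Real.sqrt_pos.mpr (by linarith)
  have hbmeas : Measurable b := by simp only [hb_def]; fun_prop
  have hcg : Continuous (toComplexFun (polyGauss Q)) :=
    Complex.continuous_ofReal.comp (continuous_polyGauss Q)
  have hig : Integrable (toComplexFun (polyGauss Q)) :=
    integrable_toComplexFun (integrable_polyGauss Q)
  have hcG : Continuous (fourierT (toComplexFun (polyGauss Q))) := continuous_fourierT hig
  have hiG : Integrable (fourierT (toComplexFun (polyGauss Q))) := by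
    have e : fourierT (toComplexFun (polyGauss Q)) = fun ξ => (-Complex.I) ^ n *
        toComplexFun (polyGauss (((2 : ℝ) ^ (m + j) * (m + j).factorial) •
          ∑ i ∈ Finset.range (m + j + 1),
            (laguerreCoeff (m + j) (n + ((d : ℝ) - 2) / 2) i * (1 / 2) ^ i) •
              (normSqPoly d ^ i * P))) ξ := by
      ext ξ
      rw [← gaussFT_apply, hQ', gaussFT_normSqPoly_pow_mul ξ hP, toComplexFun]
      congr 2
      simp only [polyGauss_smul, polyGauss_sum, polyGauss_normSqPoly_pow_mul, genLaguerre_eq_sum]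
      rw [mul_assoc, Finset.sum_mul]
      congr 1
      refine Finset.sum_congr rfl fun i _ => ?_
      rw [div_eq_mul_one_div (‖ξ‖ ^ 2), mul_pow]
      ring
    rw [e]
    exact (integrable_toComplexFun (integrable_polyGauss _)).const_mul _
  -- the two superpositions converge absolutely on the product space
  have hK : Integrable (fun p : ℝ × Rd d => ((p.1 ^ (t - 1) * (b p.1 ^ N)⁻¹ : ℝ) : ℂ) *
      toComplexFun (polyGauss Q) (b p.1 • p.2)) ((volume.restrict (Ioi 0)).prod volume) := by
    refine integrable_prod_dilation (w := fun r => r ^ (t - 1) * (b r ^ N)⁻¹) (by fun_prop) hbmeas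
      hbpos ?_ hcg hig
    have := integrableOn_rpow_mul_inv_sqrt_pow ht htm (N := N + d) (by omega)
    refine this.congr (.of_forall fun r => ?_)
    simp only [hb_def, pow_add, mul_inv]
    ring
  have hH : Integrable (fun p : ℝ × Rd d => ((p.1 ^ (t - 1) * (b p.1 ^ N)⁻¹ * (b p.1 ^ d)⁻¹ : ℝ) : ℂ) *
      fourierT (toComplexFun (polyGauss Q)) ((b p.1)⁻¹ • p.2))
      ((volume.restrict (Ioi 0)).prod volume) := by
    refine integrable_prod_dilation (w := fun r => r ^ (t - 1) * (b r ^ N)⁻¹ * (b r ^ d)⁻¹)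
      (b := fun r => (b r)⁻¹) (by fun_prop) hbmeas.inv
      (fun r hr => inv_pos.mpr (hbpos r hr)) ?_ hcG hiG
    have := integrableOn_rpow_mul_inv_sqrt_pow ht htm (N := N) (by omega)
    refine this.congr ?_
    filter_upwards [ae_restrict_mem measurableSet_Ioi] with r hr
    have := hbpos r hr
    rw [inv_pow, inv_inv, inv_mul_cancel_right₀ (by positivity)]
  have hres := (hH.integral_prod_right).const_mul (((Real.Gamma t)⁻¹ : ℝ) : ℂ)
  refine hres.congr (.of_forall fun x => ?_)
  -- pointwise, the transform of the superposition is the superposition of the transforms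
  have hae : ∀ᵐ ξ : Rd d, toComplexFun (fun ξ : Rd d =>
      ‖ξ‖ ^ (2 * s) * polyGauss (normSqPoly d ^ j * P) ξ) ξ = (((Real.Gamma t)⁻¹ : ℝ) : ℂ) *
      ∫ r in Ioi (0 : ℝ), ((r ^ (t - 1) * (b r ^ N)⁻¹ : ℝ) : ℂ) *
        toComplexFun (polyGauss Q) (b r • ξ) := by
    have : Nontrivial (Rd d) := by
      have : Nonempty (Fin d) := ⟨⟨0, hd⟩⟩
      infer_instance
    filter_upwards [compl_mem_ae_iff.mpr (measure_singleton (0 : Rd d))] with ξ hξ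
    simp only [toComplexFun]
    rw [rpow_mul_polyGauss_eq_integral hm _ hξ, Complex.ofReal_mul, ← integral_complex_ofReal]
    congr 1
    refine setIntegral_congr_fun measurableSet_Ioi fun r hr => ?_
    rw [exp_mul_polyGauss hQ hr]
    push_cast
    ring
  have hswap : Integrable (fun p : ℝ × Rd d => ((p.1 ^ (t - 1) * (b p.1 ^ N)⁻¹ : ℝ) : ℂ) *
      toComplexFun (polyGauss Q) (b p.1 • p.2) *
        Complex.exp (-(Complex.I * ((inner ℝ x p.2 : ℝ) : ℂ))))
      ((volume.restrict (Ioi 0)).prod volume) :=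
    hK.mul_bdd (c := 1) (by fun_prop) (.of_forall fun p => (norm_fourierKernel p.2 x).le)
  rw [fourierT]
  have h1 : ∫ ξ : Rd d, toComplexFun (fun ξ : Rd d =>
      ‖ξ‖ ^ (2 * s) * polyGauss (normSqPoly d ^ j * P) ξ) ξ *
        Complex.exp (-(Complex.I * ((inner ℝ x ξ : ℝ) : ℂ))) =
      (((Real.Gamma t)⁻¹ : ℝ) : ℂ) * ∫ ξ : Rd d, ∫ r in Ioi (0 : ℝ),
        ((r ^ (t - 1) * (b r ^ N)⁻¹ : ℝ) : ℂ) * toComplexFun (polyGauss Q) (b r • ξ) *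
        Complex.exp (-(Complex.I * ((inner ℝ x ξ : ℝ) : ℂ))) := by
    rw [← integral_const_mul]
    refine integral_congr_ae ?_
    filter_upwards [hae] with ξ hξ
    rw [hξ, integral_mul_const, mul_assoc]
  rw [h1, ← integral_integral_swap hswap, mul_left_comm]
  rw [← integral_const_mul (((1 / (2 * Real.pi) ^ ((d : ℝ) / 2) : ℝ) : ℂ))]
  refine congrArg _ (setIntegral_congr_fun measurableSet_Ioi fun r hr => ?_)
  have h2 := fourierT_comp_smul (toComplexFun (polyGauss Q)) (hbpos r hr) x
  rw [fourierT] at h2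
  simp only [mul_assoc] at h2 ⊢
  rw [integral_const_mul]
  symm
  rw [mul_left_comm, h2]
  push_cast
  ring

end FractionalPower

/-! ### Polar coordinates and orthogonality on the sphere -/

section SphereOrthogonality

variable {d : ℕ}

open MvPolynomial Set

/-- Polar coordinates for a radial function times a homogeneous polynomial. -/
lemma integral_radial_mul_polyVal (hd : 1 ≤ d) {N : ℕ} {Q : MvPolynomial (Fin d) ℝ}
    (hQ : Q.IsHomogeneous N) (φ : ℝ → ℝ) :
    ∫ x : Rd d, φ ‖x‖ * polyVal Q x =
      (∫ y : Metric.sphere (0 : Rd d) 1, polyVal Q y ∂(volume : Measure (Rd d)).toSphere) *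
        ∫ r in Ioi (0 : ℝ), r ^ (d - 1) * (r ^ N * φ r) := by
  have : Nonempty (Fin d) := ⟨⟨0, hd⟩⟩
  have hpt : ∀ x : ({(0 : Rd d)}ᶜ : Set (Rd d)), φ ‖x.1‖ * polyVal Q x.1 =
      (fun p : Metric.sphere (0 : Rd d) 1 × Ioi (0 : ℝ) =>
        polyVal Q p.1 * ((p.2 : ℝ) ^ N * φ p.2)) (homeomorphUnitSphereProd (Rd d) x) := by
    intro x
    have hx : ‖x.1‖ ≠ 0 := norm_ne_zero_iff.mpr x.2
    have h1 := polyVal_const_smul hQ ‖x.1‖ (‖x.1‖⁻¹ • x.1)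
    rw [smul_smul, mul_inv_cancel₀ hx, one_smul] at h1
    simp only [homeomorphUnitSphereProd_apply_fst_coe, homeomorphUnitSphereProd_apply_snd_coe]
    rw [h1]
    ring
  have hdim : Module.finrank ℝ (Rd d) - 1 = d - 1 := by simp
  calc ∫ x : Rd d, φ ‖x‖ * polyVal Q x
      = ∫ x : ({(0 : Rd d)}ᶜ : Set (Rd d)), φ ‖x.1‖ * polyVal Q x.1
          ∂((volume : Measure (Rd d)).comap (↑)) := by
        rw [integral_subtype_comap (measurableSet_singleton _).compl
          fun x : Rd d => φ ‖x‖ * polyVal Q x, restrict_compl_singleton]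
    _ = ∫ p, polyVal Q p.1 * ((p.2 : ℝ) ^ N * φ p.2)
          ∂((volume : Measure (Rd d)).toSphere.prod (.volumeIoiPow (d - 1))) := by
        rw [integral_congr_ae (.of_forall hpt), ← hdim]
        exact (volume : Measure (Rd d)).measurePreserving_homeomorphUnitSphereProd.integral_comp
          (Homeomorph.measurableEmbedding _) (fun p : Metric.sphere (0 : Rd d) 1 × Ioi (0 : ℝ) =>
            polyVal Q p.1 * ((p.2 : ℝ) ^ N * φ p.2))
    _ = (∫ y : Metric.sphere (0 : Rd d) 1, polyVal Q y ∂(volume : Measure (Rd d)).toSphere) *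
          ∫ r : Ioi (0 : ℝ), ((r : ℝ) ^ N * φ r) ∂(.volumeIoiPow (d - 1)) :=
        integral_prod_mul (fun y : Metric.sphere (0 : Rd d) 1 => polyVal Q y)
          (fun r : Ioi (0 : ℝ) => (r : ℝ) ^ N * φ r)
    _ = _ := by
        congr 1
        simp only [Measure.volumeIoiPow, ENNReal.ofReal]
        rw [integral_withDensity_eq_integral_smul,
          integral_subtype_comap measurableSet_Ioi
            fun a : ℝ => Real.toNNReal (a ^ (d - 1)) • (a ^ N * φ a),
          setIntegral_congr_fun measurableSet_Ioi fun x hx => ?_]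
        · rw [NNReal.smul_def, Real.coe_toNNReal _ (pow_nonneg (le_of_lt hx) _), smul_eq_mul]
        · exact (measurable_subtype_coe.pow_const _).real_toNNReal

/-- Gaussian Green's formula: `n ∫ P Q e^{-|x|²/2} = ∫ ∇P · ∇Q e^{-|x|²/2}` for `P` harmonic of
degree `n`. The integrals appear as Fourier transforms at the origin. -/
lemma gaussFT_zero_mul {n : ℕ} {P : MvPolynomial (Fin d) ℝ} (hP : P ∈ harmonicPoly d n)
    (Q : MvPolynomial (Fin d) ℝ) :
    (n : ℂ) * gaussFT 0 (P * Q) = ∑ i, gaussFT 0 (pderiv i P * pderiv i Q) := by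
  obtain ⟨hh, hΔ⟩ := mem_harmonicPoly.mp hP
  have hi : ∀ i, gaussFT (0 : Rd d) (X i * pderiv i P * Q) =
      gaussFT 0 (pderiv i (pderiv i P) * Q) + gaussFT 0 (pderiv i P * pderiv i Q) := by
    intro i
    rw [mul_assoc, gaussFT_X_mul, ← map_add]
    simp only [PiLp.zero_apply, Complex.ofReal_zero, mul_zero, zero_mul, sub_zero,
      Derivation.leibniz, smul_eq_mul]
    ring_nf
  have h : (n : ℂ) * gaussFT 0 (P * Q) = gaussFT 0 ((n • P) * Q) := by
    rw [smul_mul_assoc, map_nsmul, nsmul_eq_mul]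
  rw [h, ← hh.sum_X_mul_pderiv, Finset.sum_mul, map_sum, Finset.sum_congr rfl fun i _ => hi i,
    Finset.sum_add_distrib, ← map_sum, ← Finset.sum_mul, ← polyLaplacian_apply, hΔ, zero_mul,
    map_zero, zero_add]

/-- Spherical harmonics of different degrees are orthogonal on the sphere. -/
lemma sphereInner_eq_zero (hd : 1 ≤ d) {n m : ℕ} (hnm : n ≠ m) {P Q : MvPolynomial (Fin d) ℝ}
    (hP : P ∈ harmonicPoly d n) (hQ : Q ∈ harmonicPoly d m) : sphereInner P Q = 0 := by
  have h1 := gaussFT_zero_mul hP Q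
  have h2 := gaussFT_zero_mul hQ P
  have h3 : gaussFT (0 : Rd d) (P * Q) = 0 := by
    rw [mul_comm Q P] at h2
    simp only [mul_comm (pderiv _ Q)] at h2
    have h4 : ((n : ℂ) - m) * gaussFT 0 (P * Q) = 0 := by linear_combination h1 - h2
    refine (mul_eq_zero.mp h4).resolve_left (sub_ne_zero.mpr ?_)
    exact_mod_cast hnm
  have hhom : (P * Q).IsHomogeneous (n + m) :=
    (mem_harmonicPoly.mp hP).1.mul (mem_harmonicPoly.mp hQ).1
  have h5 : ∫ x : Rd d, Real.exp (-‖x‖ ^ 2 / 2) * polyVal (P * Q) x = 0 := by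
    rw [gaussFT_apply, fourierT] at h3
    have hc : (((1 / (2 * Real.pi) ^ ((d : ℝ) / 2) : ℝ)) : ℂ) ≠ 0 := by
      exact_mod_cast (by positivity : (1 / (2 * Real.pi) ^ ((d : ℝ) / 2) : ℝ) ≠ 0)
    have h6 := (mul_eq_zero.mp h3).resolve_left hc
    simp only [inner_zero_left, Complex.ofReal_zero, mul_zero, neg_zero, Complex.exp_zero, mul_one,
      toComplexFun] at h6
    rw [integral_complex_ofReal, Complex.ofReal_eq_zero] at h6
    rw [← h6]
    exact integral_congr_ae (.of_forall fun x => mul_comm _ _)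
  rw [integral_radial_mul_polyVal hd hhom (fun r => Real.exp (-r ^ 2 / 2))] at h5
  have h7 : ∫ r in Ioi (0 : ℝ), r ^ (d - 1) * (r ^ (n + m) * Real.exp (-r ^ 2 / 2)) ≠ 0 := by
    have h8 := integral_rpow_mul_exp_neg_mul_rpow (p := 2) (q := ((d - 1 + (n + m) : ℕ) : ℝ))
      (b := 1 / 2) two_pos (by have := (d - 1 + (n + m)).cast_nonneg (α := ℝ); linarith)
      (by norm_num)
    have h9 : ∫ r in Ioi (0 : ℝ), r ^ (d - 1) * (r ^ (n + m) * Real.exp (-r ^ 2 / 2)) =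
        ∫ r in Ioi (0 : ℝ), r ^ (((d - 1 + (n + m) : ℕ) : ℝ)) * Real.exp (-(1 / 2) * r ^ (2 : ℝ)) := by
      refine setIntegral_congr_fun measurableSet_Ioi fun r _ => ?_
      simp only [Real.rpow_natCast, Real.rpow_two, pow_add]
      rw [show -(1 / 2) * r ^ 2 = -r ^ 2 / 2 by ring]
      ring
    rw [h9, h8]
    have : 0 < Real.Gamma ((((d - 1 + (n + m) : ℕ) : ℝ) + 1) / 2) :=
      Real.Gamma_pos_of_pos (by positivity)
    positivity
  have h10 := (mul_eq_zero.mp h5).resolve_right h7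
  rw [sphereInner, ← h10]
  simp only [polyVal_mul]

end SphereOrthogonality

/-! ### Weighted orthogonality of the generalised Hermite functions -/

section HermiteOrthogonality

variable {d : ℕ}

open MvPolynomial Set

lemma integral_rpow_mul_exp_neg_sq {q : ℝ} (hq : -1 < q) :
    ∫ r in Ioi (0 : ℝ), r ^ q * Real.exp (-r ^ 2) = 1 / 2 * Real.Gamma ((q + 1) / 2) := by
  rw [← integral_rpow_mul_exp_neg_rpow two_pos hq]
  simp only [Real.rpow_two]

lemma integrableOn_rpow_mul_exp_neg_sq {q : ℝ} (hq : -1 < q) :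
    IntegrableOn (fun r : ℝ => r ^ q * Real.exp (-r ^ 2)) (Ioi 0) := by
  have := integrableOn_rpow_mul_exp_neg_rpow hq two_pos
  simpa only [Real.rpow_two] using this

/-- The radial orthogonality relation: Laguerre polynomials in `r²` against `r^{2α+1} e^{-r²}`. -/
lemma integral_genLaguerre_mul_genLaguerre {α : ℝ} (hα : -1 < α) (k j : ℕ) :
    ∫ r in Ioi (0 : ℝ), r ^ (2 * α + 1) * Real.exp (-r ^ 2) *
      (genLaguerre k α (r ^ 2) * genLaguerre j α (r ^ 2)) =
      if j = k then Real.Gamma (α + 1 + k) / (2 * k.factorial) else 0 := by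
  have hq : ∀ i l : ℕ, -1 < 2 * α + 1 + 2 * (i + l) := fun i l => by
    have h1 := i.cast_nonneg (α := ℝ)
    have h2 := l.cast_nonneg (α := ℝ)
    linarith
  have e : ∀ r ∈ Ioi (0 : ℝ), r ^ (2 * α + 1) * Real.exp (-r ^ 2) *
      (genLaguerre k α (r ^ 2) * genLaguerre j α (r ^ 2)) =
      ∑ i ∈ Finset.range (k + 1), ∑ l ∈ Finset.range (j + 1),
        laguerreCoeff k α i * laguerreCoeff j α l *
          (r ^ (2 * α + 1 + 2 * (i + l)) * Real.exp (-r ^ 2)) := by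
    intro r hr
    rw [genLaguerre_eq_sum, genLaguerre_eq_sum, Finset.sum_mul_sum, Finset.mul_sum]
    refine Finset.sum_congr rfl fun i _ => ?_
    rw [Finset.mul_sum]
    refine Finset.sum_congr rfl fun l _ => ?_
    have : r ^ (2 * ((i : ℝ) + l)) = (r ^ 2) ^ i * (r ^ 2) ^ l := by
      rw [← pow_add, ← pow_mul, ← Real.rpow_natCast]
      push_cast
      rfl
    rw [Real.rpow_add hr (2 * α + 1), this]
    ring
  have hint : ∀ i l : ℕ, IntegrableOn (fun r : ℝ => laguerreCoeff k α i * laguerreCoeff j α l *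
      (r ^ (2 * α + 1 + 2 * ((i : ℝ) + l)) * Real.exp (-r ^ 2))) (Ioi 0) := fun i l =>
    (integrableOn_rpow_mul_exp_neg_sq (hq i l)).const_mul _
  rw [setIntegral_congr_fun measurableSet_Ioi e, integral_finsetSum]
  · have h2 : ∀ i ∈ Finset.range (k + 1), ∫ r in Ioi (0 : ℝ), ∑ l ∈ Finset.range (j + 1),
        laguerreCoeff k α i * laguerreCoeff j α l *
          (r ^ (2 * α + 1 + 2 * ((i : ℝ) + l)) * Real.exp (-r ^ 2)) =
        1 / 2 * ∑ l ∈ Finset.range (j + 1),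
          laguerreCoeff k α i * laguerreCoeff j α l * Real.Gamma (α + 1 + i + l) := by
      intro i _
      rw [integral_finsetSum _ fun l _ => hint i l, Finset.mul_sum]
      refine Finset.sum_congr rfl fun l _ => ?_
      rw [integral_const_mul, integral_rpow_mul_exp_neg_sq (hq i l),
        show (2 * α + 1 + 2 * ((i : ℝ) + l) + 1) / 2 = α + 1 + i + l by ring]
      ring
    rw [Finset.sum_congr rfl h2, ← Finset.mul_sum, sum_laguerreCoeff_mul_laguerreCoeff_mul_Gamma hα]
    split_ifs
    · ring
    · simp
  · exact fun i _ => integrable_finsetSum _ fun l _ => hint i l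

/-- Weighted orthonormality of the GHFs, in terms of the inner product on the sphere. -/
lemma integral_rpow_mul_genHermiteFun_mul (hd : 1 ≤ d) {s : ℝ} (hs : 0 < s) {n m : ℕ}
    {P Q : MvPolynomial (Fin d) ℝ} (hP : P ∈ harmonicPoly d n) (hQ : Q ∈ harmonicPoly d m)
    (k j : ℕ) :
    ∫ x : Rd d, (‖x‖ ^ s * genHermiteFun s n k P x) * (‖x‖ ^ s * genHermiteFun s m j Q x) =
      if n = m ∧ j = k then sphereInner P Q else 0 := by
  have hhom : (P * Q).IsHomogeneous (n + m) :=
    (mem_harmonicPoly.mp hP).1.mul (mem_harmonicPoly.mp hQ).1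
  set φ : ℝ → ℝ := fun r => r ^ s * r ^ s * Real.exp (-r ^ 2) *
    (√(1 / hermiteGamma d s n k) * √(1 / hermiteGamma d s m j)) *
    (genLaguerre k (n + ((d : ℝ) - 2) / 2 + s) (r ^ 2) *
      genLaguerre j (m + ((d : ℝ) - 2) / 2 + s) (r ^ 2)) with hφ
  have e : ∀ x : Rd d,
      (‖x‖ ^ s * genHermiteFun s n k P x) * (‖x‖ ^ s * genHermiteFun s m j Q x) =
      φ ‖x‖ * polyVal (P * Q) x := by
    intro x
    have hexp : Real.exp (-‖x‖ ^ 2) = Real.exp (-‖x‖ ^ 2 / 2) * Real.exp (-‖x‖ ^ 2 / 2) := by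
      rw [← Real.exp_add]; ring_nf
    simp only [hφ, genHermiteFun, genHermitePoly, polyVal_mul, hexp]
    ring
  have hsph : ∫ y : Metric.sphere (0 : Rd d) 1, polyVal (P * Q) y
      ∂(volume : Measure (Rd d)).toSphere = sphereInner P Q := by
    simp only [sphereInner, polyVal_mul]
  rw [integral_congr_ae (.of_forall e), integral_radial_mul_polyVal hd hhom, hsph]
  by_cases hnm : n = m
  swap
  · rw [sphereInner_eq_zero hd hnm hP hQ]
    simp
  subst hnm
  set α : ℝ := n + ((d : ℝ) - 2) / 2 + s with hα_def
  have hd' : (1 : ℝ) ≤ d := by exact_mod_cast hd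
  have hα : -1 < α := by
    have := n.cast_nonneg (α := ℝ)
    rw [hα_def]
    linarith
  have hrad : ∫ r in Ioi (0 : ℝ), r ^ (d - 1) * (r ^ (n + n) * φ r) =
      (√(1 / hermiteGamma d s n k) * √(1 / hermiteGamma d s n j)) *
        ∫ r in Ioi (0 : ℝ), r ^ (2 * α + 1) * Real.exp (-r ^ 2) *
          (genLaguerre k α (r ^ 2) * genLaguerre j α (r ^ 2)) := by
    rw [← integral_const_mul]
    refine setIntegral_congr_fun measurableSet_Ioi fun r hr => ?_
    have hr0 : (0 : ℝ) < r := hr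
    have hpow : r ^ (2 * α + 1) = r ^ (d - 1) * r ^ (n + n) * (r ^ s * r ^ s) := by
      rw [← Real.rpow_natCast, ← Real.rpow_natCast, ← Real.rpow_add hr0, ← Real.rpow_add hr0,
        ← Real.rpow_add hr0]
      congr 1
      rw [hα_def, Nat.cast_sub hd]
      push_cast
      ring
    simp only [hφ, hpow]
    ring
  rw [hrad, integral_genLaguerre_mul_genLaguerre hα]
  by_cases hjk : j = k
  · subst hjk
    have hG : Real.Gamma (α + 1 + j) / (2 * j.factorial) = hermiteGamma d s n j := by
      rw [hermiteGamma, hα_def]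
      congr 2
      ring
    have hpos : 0 < hermiteGamma d s n j := by
      have := Real.Gamma_pos_of_pos (hermite_Gamma_arg_pos hd (μ := s) (by linarith) n j)
      rw [hermiteGamma]
      positivity
    rw [if_pos rfl, if_pos ⟨rfl, rfl⟩, hG, Real.mul_self_sqrt (by positivity), one_div,
      inv_mul_cancel₀ hpos.ne', mul_one]
  · rw [if_neg hjk, if_neg (fun h => hjk h.2), mul_zero, mul_zero]

end HermiteOrthogonality

/-! ### The fractional Laplacian of the adjoint functions -/

section FractionalLaplacian

variable {d : ℕ}

open MvPolynomial

lemma integrable_rpow_mul_polyGauss (P : MvPolynomial (Fin d) ℝ) {s : ℝ} (hs : 0 < s) :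
    Integrable fun x : Rd d => ‖x‖ ^ (2 * s) * polyGauss P x := by
  obtain ⟨m, hm⟩ := exists_nat_gt s
  have hc : Continuous fun x : Rd d => ‖x‖ ^ (2 * s) * polyGauss P x :=
    (continuous_norm.rpow_const fun _ => Or.inr (by positivity)).mul (continuous_polyGauss P)
  refine ((integrable_polyGauss P).norm.add
    (integrable_polyGauss (normSqPoly d ^ m * P)).norm).mono' hc.aestronglyMeasurable
    (.of_forall fun x => ?_)
  have hb : ‖x‖ ^ (2 * s) ≤ 1 + (‖x‖ ^ 2) ^ m := by
    rw [Real.rpow_mul (norm_nonneg x), Real.rpow_two]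
    rcases le_total (‖x‖ ^ 2) 1 with h | h
    · have h1 := Real.rpow_le_one (by positivity) h hs.le
      have h2 : 0 ≤ (‖x‖ ^ 2) ^ m := by positivity
      linarith
    · have h1 := Real.rpow_le_rpow_of_exponent_le h hm.le
      rw [Real.rpow_natCast] at h1
      linarith
  simp only [Pi.add_apply]
  rw [norm_mul, polyGauss_normSqPoly_pow_mul, norm_mul, Real.norm_of_nonneg (by positivity),
    Real.norm_of_nonneg (by positivity : 0 ≤ (‖x‖ ^ 2) ^ m), ← one_add_mul]
  gcongr

lemma fourierTInv_const_mul (c : ℂ) (u : Rd d → ℂ) (x : Rd d) :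
    fourierTInv (fun ξ => c * u ξ) x = c * fourierTInv u x := by
  simp only [fourierTInv_eq_fourierT_neg, fourierT_const_mul]

lemma fourierT_sum {ι : Type*} (t : Finset ι) (u : ι → Rd d → ℂ)
    (hu : ∀ i ∈ t, Integrable (u i)) (ξ : Rd d) :
    fourierT (fun x => ∑ i ∈ t, u i x) ξ = ∑ i ∈ t, fourierT (u i) ξ := by
  simp only [fourierT, Finset.sum_mul]
  rw [integral_finsetSum _ fun i hi => integrable_mul_fourierKernel (hu i hi) ξ, Finset.mul_sum]

lemma integrable_rpow_mul_genHermiteFun (μ : ℝ) (n k : ℕ) (P : MvPolynomial (Fin d) ℝ) {s : ℝ}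
    (hs : 0 < s) : Integrable fun x : Rd d => ‖x‖ ^ (2 * s) * genHermiteFun μ n k P x := by
  rw [genHermiteFun_eq_polyGauss]
  exact integrable_rpow_mul_polyGauss _ hs

lemma continuous_rpow_mul_genHermiteFun (μ : ℝ) (n k : ℕ) (P : MvPolynomial (Fin d) ℝ) {s : ℝ}
    (hs : 0 < s) : Continuous fun x : Rd d => ‖x‖ ^ (2 * s) * genHermiteFun μ n k P x := by
  rw [genHermiteFun_eq_polyGauss]
  exact (continuous_norm.rpow_const fun _ => Or.inr (by positivity)).mul (continuous_polyGauss _)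

lemma integrable_fourierTInv_rpow_mul_genHermiteFun (hd : 1 ≤ d) (μ : ℝ) {n : ℕ}
    {P : MvPolynomial (Fin d) ℝ} (hP : P ∈ harmonicPoly d n) (k : ℕ) {s : ℝ} (hs : 0 < s) :
    Integrable (fourierTInv
      (toComplexFun fun x : Rd d => ‖x‖ ^ (2 * s) * genHermiteFun μ n k P x)) := by
  set c : ℕ → ℝ := fun i => √(1 / hermiteGamma d μ n k) *
    laguerreCoeff k (n + ((d : ℝ) - 2) / 2 + μ) i
  have e1 : (toComplexFun fun x : Rd d => ‖x‖ ^ (2 * s) * genHermiteFun μ n k P x) =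
      fun x => ∑ i ∈ Finset.range (k + 1), (c i : ℂ) *
        toComplexFun (fun x : Rd d => ‖x‖ ^ (2 * s) * polyGauss (normSqPoly d ^ i * P) x) x := by
    ext x
    simp only [toComplexFun, genHermiteFun_eq_polyGauss, hermiteMvPoly, polyGauss_smul,
      polyGauss_sum, ← Complex.ofReal_mul, ← Complex.ofReal_sum, Finset.mul_sum]
    congr 1
    refine Finset.sum_congr rfl fun i _ => ?_
    simp only [c]
    ring
  have e2 : fourierTInv (toComplexFun fun x : Rd d => ‖x‖ ^ (2 * s) * genHermiteFun μ n k P x) =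
      fun x => ∑ i ∈ Finset.range (k + 1), (c i : ℂ) * fourierT (toComplexFun
        fun x : Rd d => ‖x‖ ^ (2 * s) * polyGauss (normSqPoly d ^ i * P) x) (-x) := by
    ext x
    rw [fourierTInv_eq_fourierT_neg, e1, fourierT_sum]
    · simp only [fourierT_const_mul]
    · exact fun i _ =>
        (integrable_toComplexFun (integrable_rpow_mul_polyGauss _ hs)).const_mul _
  rw [e2]
  exact integrable_finsetSum _ fun i _ =>
    ((integrable_fourierT_rpow_mul_polyGauss hd hP i hs).comp_neg).const_mul _

lemma rpow_mul_fourierT_adjHermiteFun (hd : 1 ≤ d) {μ : ℝ} (hμ : -1 / 2 < μ) {n : ℕ}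
    {P : MvPolynomial (Fin d) ℝ} (hP : P ∈ harmonicPoly d n) (k : ℕ) (s : ℝ) :
    (fun ξ : Rd d => ((‖ξ‖ ^ (2 * s) : ℝ) : ℂ) * fourierT (toComplexFun (adjHermiteFun μ n k P)) ξ) =
      fun ξ => (-Complex.I) ^ (n + 2 * k) *
        toComplexFun (fun x : Rd d => ‖x‖ ^ (2 * s) * genHermiteFun μ n k P x) ξ := by
  ext ξ
  rw [fourierT_adjHermiteFun hd hμ hP, toComplexFun]
  push_cast
  ring

lemma continuous_const_mul_toComplexFun (c : ℂ) {u : Rd d → ℝ} (hu : Continuous u) :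
    Continuous fun x => c * toComplexFun u x :=
  continuous_const.mul (Complex.continuous_ofReal.comp hu)

/-- The fractional Laplacian of an A-GHF is the inverse transform of a power times a GHF. -/
lemma fracLaplacian_adjHermiteFun (hd : 1 ≤ d) {μ : ℝ} (hμ : -1 / 2 < μ) {n : ℕ}
    {P : MvPolynomial (Fin d) ℝ} (hP : P ∈ harmonicPoly d n) (k : ℕ) (s : ℝ) :
    fracLaplacian s (toComplexFun (adjHermiteFun μ n k P)) =
      fourierTInv fun ξ => (-Complex.I) ^ (n + 2 * k) *
        toComplexFun (fun x : Rd d => ‖x‖ ^ (2 * s) * genHermiteFun μ n k P x) ξ := by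
  rw [fracLaplacian, rpow_mul_fourierT_adjHermiteFun hd hμ hP]

lemma integrable_fracLaplacian_adjHermiteFun (hd : 1 ≤ d) {μ : ℝ} (hμ : -1 / 2 < μ) {n : ℕ}
    {P : MvPolynomial (Fin d) ℝ} (hP : P ∈ harmonicPoly d n) (k : ℕ) {s : ℝ} (hs : 0 < s) :
    Integrable (fracLaplacian s (toComplexFun (adjHermiteFun μ n k P))) := by
  rw [fracLaplacian_adjHermiteFun hd hμ hP]
  refine ((integrable_fourierTInv_rpow_mul_genHermiteFun hd μ hP k hs).const_mul
    ((-Complex.I) ^ (n + 2 * k))).congr (.of_forall fun x => ?_)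
  rw [fourierTInv_const_mul]

lemma fourierTInv_genHermiteFun (hd : 1 ≤ d) {μ : ℝ} (hμ : -1 / 2 < μ) {n : ℕ}
    {P : MvPolynomial (Fin d) ℝ} (hP : P ∈ harmonicPoly d n) (k : ℕ) (x : Rd d) :
    fourierTInv (toComplexFun (genHermiteFun μ n k P)) x =
      Complex.I ^ (n + 2 * k) * (adjHermiteFun μ n k P x : ℂ) := by
  rw [fourierTInv_toComplexFun, fourierT_genHermiteFun hd hμ hP]
  simp

lemma fourierT_fracLaplacian_adjHermiteFun (hd : 1 ≤ d) {μ : ℝ} (hμ : -1 / 2 < μ) {n : ℕ}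
    {P : MvPolynomial (Fin d) ℝ} (hP : P ∈ harmonicPoly d n) (k : ℕ) {s : ℝ} (hs : 0 < s)
    (ξ : Rd d) :
    fourierT (fracLaplacian s (toComplexFun (adjHermiteFun μ n k P))) ξ =
      (-Complex.I) ^ (n + 2 * k) * ((‖ξ‖ ^ (2 * s) : ℝ) : ℂ) *
        (genHermiteFun μ n k P ξ : ℂ) := by
  have hF := integrable_fracLaplacian_adjHermiteFun hd hμ hP k hs
  rw [fracLaplacian_adjHermiteFun hd hμ hP] at hF ⊢
  rw [fourierT_fourierTInv (continuous_const_mul_toComplexFun _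
      (continuous_rpow_mul_genHermiteFun μ n k P hs))
    ((integrable_toComplexFun (integrable_rpow_mul_genHermiteFun μ n k P hs)).const_mul _) hF,
    toComplexFun]
  push_cast
  ring

/-- By Parseval, the Sobolev inner product of two A-GHFs is a weighted inner product of GHFs. -/
lemma innerRd_fracLaplacian_adjHermiteFun (hd : 1 ≤ d) {s : ℝ} (hs : 0 < s) {n m : ℕ}
    {P Q : MvPolynomial (Fin d) ℝ} (hP : P ∈ harmonicPoly d n) (hQ : Q ∈ harmonicPoly d m)
    (k j : ℕ) :
    innerRd (fracLaplacian (s / 2) (toComplexFun (adjHermiteFun s n k P)))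
        (fracLaplacian (s / 2) (toComplexFun (adjHermiteFun s m j Q))) =
      if n = m ∧ j = k then (sphereInner P Q : ℂ) else 0 := by
  have hs2 : 0 < s / 2 := half_pos hs
  have hμ : -1 / 2 < s := by linarith
  have hF := integrable_fracLaplacian_adjHermiteFun hd hμ hP k hs2
  rw [fracLaplacian_adjHermiteFun hd hμ hP] at hF ⊢
  rw [fracLaplacian_adjHermiteFun hd hμ hQ, innerRd_fourierTInv
    (continuous_const_mul_toComplexFun _ (continuous_rpow_mul_genHermiteFun s n k P hs2))
    ((integrable_toComplexFun (integrable_rpow_mul_genHermiteFun s n k P hs2)).const_mul _) hF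
    ((integrable_toComplexFun (integrable_rpow_mul_genHermiteFun s m j Q hs2)).const_mul _)]
  have e : ∀ ξ : Rd d, (-Complex.I) ^ (n + 2 * k) *
        toComplexFun (fun x : Rd d => ‖x‖ ^ (2 * (s / 2)) * genHermiteFun s n k P x) ξ *
      (starRingEnd ℂ) ((-Complex.I) ^ (m + 2 * j) *
        toComplexFun (fun x : Rd d => ‖x‖ ^ (2 * (s / 2)) * genHermiteFun s m j Q x) ξ) =
      ((-Complex.I) ^ (n + 2 * k) * Complex.I ^ (m + 2 * j)) *
        (((‖ξ‖ ^ s * genHermiteFun s n k P ξ) * (‖ξ‖ ^ s * genHermiteFun s m j Q ξ) : ℝ) : ℂ) := by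
    intro ξ
    rw [mul_div_cancel₀ s two_ne_zero]
    simp only [toComplexFun, map_mul, map_pow, map_neg, Complex.conj_I, neg_neg, Complex.conj_ofReal]
    push_cast
    ring
  rw [integral_congr_ae (.of_forall e), integral_const_mul, integral_complex_ofReal,
    integral_rpow_mul_genHermiteFun_mul hd hs hP hQ]
  split_ifs with h
  · obtain ⟨rfl, rfl⟩ := h
    rw [← mul_pow, neg_mul, Complex.I_mul_I, neg_neg, one_pow, one_mul]
  · simp

end FractionalLaplacian

end

theorem theorem2p3 (d : ℕ) (hd : 1 ≤ d)
    (Y : (n : ℕ) → Fin (harmonicDim d n) → MvPolynomial (Fin d) ℝ)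
    (hY : IsSphericalHarmonicBasis d Y) :
    (∀ μ : ℝ, -1 / 2 < μ → ∀ (n : ℕ) (ℓ : Fin (harmonicDim d n)) (k : ℕ),
      -- the transform of the A-GHF is the GHF, and the reverse
      (Integrable (toComplexFun (adjHermiteFun μ n k (Y n ℓ))) ∧
        ∀ ξ : Rd d, fourierT (toComplexFun (adjHermiteFun μ n k (Y n ℓ))) ξ =
          (-Complex.I) ^ (n + 2 * k) * (genHermiteFun μ n k (Y n ℓ) ξ : ℂ)) ∧
      (Integrable (toComplexFun (genHermiteFun μ n k (Y n ℓ))) ∧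
        ∀ x : Rd d, fourierTInv (toComplexFun (genHermiteFun μ n k (Y n ℓ))) x =
          Complex.I ^ (n + 2 * k) * (adjHermiteFun μ n k (Y n ℓ) x : ℂ)) ∧
      -- the transform of the fractional Laplacian of the A-GHF
      ∀ s : ℝ, 0 < s →
        Integrable (fun ξ : Rd d => ((‖ξ‖ ^ (2 * s) : ℝ) : ℂ) *
          fourierT (toComplexFun (adjHermiteFun μ n k (Y n ℓ))) ξ) ∧
        Integrable (fracLaplacian s (toComplexFun (adjHermiteFun μ n k (Y n ℓ)))) ∧
        ∀ ξ : Rd d,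
          fourierT (fracLaplacian s (toComplexFun (adjHermiteFun μ n k (Y n ℓ)))) ξ =
            (-Complex.I) ^ (n + 2 * k) * ((‖ξ‖ ^ (2 * s) : ℝ) : ℂ) *
              (genHermiteFun μ n k (Y n ℓ) ξ : ℂ)) ∧
    -- orthonormality of the A-GHFs
    (∀ s : ℝ, 0 < s →
      (∀ (n : ℕ) (ℓ : Fin (harmonicDim d n)) (k : ℕ),
        MemLp (fracLaplacian (s / 2) (toComplexFun (adjHermiteFun s n k (Y n ℓ)))) 2) ∧
      ∀ (n m : ℕ) (ℓ : Fin (harmonicDim d n)) (ι : Fin (harmonicDim d m)) (k j : ℕ),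
        innerRd (fracLaplacian (s / 2) (toComplexFun (adjHermiteFun s n k (Y n ℓ))))
            (fracLaplacian (s / 2) (toComplexFun (adjHermiteFun s m j (Y m ι)))) =
          if j = k ∧ m = n ∧ (ℓ : ℕ) = (ι : ℕ) then 1 else 0) := by
  refine ⟨fun μ hμ n ℓ k => ?_, fun s hs => ⟨fun n ℓ k => ?_, fun n m ℓ ι k j => ?_⟩⟩
  · have hP := hY.mem n ℓ
    refine ⟨⟨?_, fourierT_adjHermiteFun hd hμ hP k⟩, ⟨?_, fourierTInv_genHermiteFun hd hμ hP k⟩,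
      fun s hs => ⟨?_, integrable_fracLaplacian_adjHermiteFun hd hμ hP k hs,
        fourierT_fracLaplacian_adjHermiteFun hd hμ hP k hs⟩⟩
    · rw [adjHermiteFun_eq_polyGauss]
      exact integrable_toComplexFun (integrable_polyGauss _)
    · rw [genHermiteFun_eq_polyGauss]
      exact integrable_toComplexFun (integrable_polyGauss _)
    · rw [rpow_mul_fourierT_adjHermiteFun hd hμ hP]
      exact (integrable_toComplexFun (integrable_rpow_mul_genHermiteFun μ n k _ hs)).const_mul _
  · exact memLp_two_fourierTInv (integrable_fracLaplacian_adjHermiteFun hd (by linarith)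
      (hY.mem n ℓ) k (half_pos hs))
  · rw [innerRd_fracLaplacian_adjHermiteFun hd hs (hY.mem n ℓ) (hY.mem m ι)]
    by_cases hnm : n = m
    · subst hnm
      rw [hY.orthonormal]
      by_cases hjk : j = k <;> by_cases hl : ℓ = ι <;> simp [hjk, hl, Fin.val_inj]
    · rw [if_neg fun h => hnm h.1, if_neg fun h => hnm h.2.1.symm]
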